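/- **Setting.** Let $\kappa\in\mathbb N$ and let $(X^{(k)}_i)_{i\ge 1}$, $k=1,\dots,\kappa+1$, be $\kappa+1$ sequences of real random variables on one probability space. For $m,l\in\mathbb N$ let $B^{m,l}$ be the partition of $\mathbb R^m$ into half-open dyadic cubes of side $2^{-l}$. For a finite sequence $x=(x_1,\dots,x_N)$ and $B\in B^{m,l}$ let $\nu(x,B)=\frac{1}{N-m+1}\#\{i\le N-m+1:(x_i,\dots,x_{i+m-1})\in B\}$ if $N\ge m$, and $\nu(x,B)=0$ otherwise. A probability law $\rho$ on $\mathbb R^{\mathbb N}$ is *stationary* if for every cube $B\in B^{m,l}$ the probability that the block of length $m$ at position $i$ lies in $B$ does not depend on $i$; it is *stationary ergodic* if moreover, for every such $B$, $\nu(X_{1..n},B)\to\rho(X_{1..m}\in B)$ $\rho$-almost surely as $n\to\infty$ (equivalent to the usual definition). Assume that the law of every row $X^{(k)}$ is stationary ergodic and that the laws of consecutive rows are different; the joint law is otherwise arbitrary. Let $0=\theta_0<\theta_1<\dots<\theta_\kappa<\theta_{\kappa+1}=1$. For each $n$ the sample $x=(x_1,\dots,x_n)$ has, at the positions $\lfloor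 n\theta_{k-1}\rfloor+1,\dots,\lfloor n\theta_k\rfloor$, the first elements of row $k$, for $k=1,\dots,\kappa+1$. **Distance.** Put $w_j=\frac1{j(j+1)}$ and let $(m_N)$, $(l_N)$ be any sequences of natural numbers tending to infinity. For finite sequences $x,y$, with $N$ the larger of their lengths, let $$\hat d(x,y)=\sum_{m=1}^{m_N}\sum_{l=1}^{l_N}w_mw_l\sum_{B\in B^{m,l}}|\nu(x,B)-\nu(y,B)|.$$ For a sample $x_1,\dots,x_n$ write $X_{a..b}=(x_a,\dots,x_b)$, with $a$ and $b$ clipped to $1..n$. Let $\Delta(a,b)=\hat d(X_{a..\lfloor(a+b)/2\rfloor},X_{\lceil(a+b)/2\rceil..b})$, and let $\Phi(a,b,\alpha)$ be a maximizer over $t\in\{a,\dots,b\}$ of $\hat d(X_{a-\lfloor n\alpha\rfloor..t},X_{t..b+\lfloor n\alpha\rfloor})$. **Algorithm** (input $x_1,\dots,x_n$ and $\kappa$). For $j=1,\dots,\lfloor\log_2n\rfloor$ and $t=1,\dots,\kappa+1$, let $\alpha_j=2^{-j}/3$, $N_{t,j}=\lfloor\frac1{\alpha_j}-\frac1{t+1}\rfloor$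 and $b_i=\max\bigl(1,\lfloor n\alpha_j(i+\tfrac1{t+1})\rfloor\bigr)$ for $0\le i\le N_{t,j}$. 1. For $l=0,1,2$ let $\gamma_l$ be the $\kappa$-th highest of the values $\Delta(b_{l+3(i-1)},b_{l+3i})$, $1\le i\le\lfloor(N_{t,j}-l)/3\rfloor$ (and $0$ if there are fewer than $\kappa$ of them); put $\gamma(t,j)=\min(\gamma_0,\gamma_1,\gamma_2)$. 2. Among the grid segments $(b_i,b_{i+1})$, $0\le i<N_{t,j}$, select $\kappa$ segments with highest $\Delta(b_i,b_{i+1})$, list them from left to right, and let $\hat\pi^{t,j}_k=\Phi(b_{i},b_{i+1},\alpha_j)$ for the $k$-th listed segment $(b_i,b_{i+1})$. (If there are fewer than $\kappa$ segments, the $\hat\pi^{t,j}_k$ are arbitrary; then $\gamma(t,j)=0$.) Output $$\hat\theta_k(n)=\frac1{n\eta}\sum_{j=1}^{\lfloor\log_2 n\rfloor}\sum_{t=1}^{\kappa+1}2^{-j}\gamma(t,j)\,\hat\pi_k^{t,j},\qquad \eta=\sum_{j=1}^{\lfloor\log_2 n\rfloor}\sum_{t=1}^{\kappa+1}2^{-j}\gamma(t,j),\qquad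 k=1,\dots,\kappa,$$ where $\hat\theta_k(n)$ is taken to be $0$ if $n\eta=0$. **Theorem.** Almost surely, however the ties in the choice of the maximizers and of the selected segments are broken, $$\lim_{n\to\infty}\ \sup_{k=1..\kappa}|\hat\theta_k(n)-\theta_k|=0 .$$ -/

import Mathlib

open Filter Topology MeasureTheory

namespace ChangePoint

/-! ### Frequencies, stationary ergodic processes, and the empirical distance -/

/-- The dyadic cube of side `2 ^ (-l)` (volume `2 ^ (-(m * l))`) in `ℝ^m` whose lower corner is
`2 ^ (-l) • c`. For fixed `m, l` these cubes, indexed by `c : Fin m → ℤ`, are the partition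
`B^{m,l}` of `ℝ^m`. -/
def cube {m : ℕ} (l : ℕ) (c : Fin m → ℤ) : Set (Fin m → ℝ) :=
  {y | ∀ r, (c r : ℝ) / 2 ^ l ≤ y r ∧ y r < ((c r : ℝ) + 1) / 2 ^ l}

/-- The block `(x_i, …, x_{i+m-1})`. -/
def block (x : ℕ → ℝ) (m i : ℕ) : Fin m → ℝ := fun r => x (i + r)

open Classical in
/-- The frequency `ν(X_{a..b}, B)` with which the finite sequence `X_{a..b} = x_a, …, x_b`
(both ends included, length `b + 1 - a`) falls in `B ⊆ ℝ^m`; it is `0` if the sequence is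
shorter than `m`. -/
noncomputable def freq (x : ℕ → ℝ) (a b : ℕ) {m : ℕ} (B : Set (Fin m → ℝ)) : ℝ :=
  if m ≤ b + 1 - a then
    (((Finset.Icc a (b + 1 - m)).filter fun i => block x m i ∈ B).card : ℝ) /
      ((b + 1 - a - m + 1 : ℕ) : ℝ)
  else 0

/-- A process distribution (a measure on sequences) is stationary if the law of the block of
length `m` at position `i` does not depend on `i`, on all cubes. -/
def IsStationary (μ : Measure (ℕ → ℝ)) : Prop :=
  ∀ (m l : ℕ) (c : Fin m → ℤ) (i : ℕ),
    μ {y | block y m i ∈ cube l c} = μ {y | block y m 0 ∈ cube l c}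

/-- A process distribution is stationary ergodic if it is stationary and, almost surely, the
frequency of every cube in the initial segments of the sequence converges to the probability of
that cube. -/
def IsStationaryErgodic (μ : Measure (ℕ → ℝ)) : Prop :=
  IsStationary μ ∧ ∀ (m l : ℕ) (c : Fin m → ℤ), ∀ᵐ y ∂μ,
    Tendsto (fun n : ℕ => freq y 0 n (cube l c)) atTop
      (𝓝 (μ.real {y | block y m 0 ∈ cube l c}))

/-- The weights `w_j = 1 / (j (j + 1))` of the distributional distance. -/
noncomputable def weight (j : ℕ) : ℝ := 1 / ((j : ℝ) * ((j : ℝ) + 1))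

/-- The empirical distributional distance `d̂(X_{a..b}, X_{a'..b'})` with truncation sequences
`M, L` evaluated at the larger of the two lengths. -/
noncomputable def dHat (M L : ℕ → ℕ) (x : ℕ → ℝ) (a b a' b' : ℕ) : ℝ :=
  ∑ m ∈ Finset.Icc 1 (M (max (b + 1 - a) (b' + 1 - a'))),
    ∑ l ∈ Finset.Icc 1 (L (max (b + 1 - a) (b' + 1 - a'))),
      weight m * weight l *
        ∑' c : Fin m → ℤ, |freq x a b (cube l c) - freq x a' b' (cube l c)|

/-! ### The score function and the single-change-point estimator -/

/-- The score `Δ_x(a, b) = d̂(X_{a..⌊(a+b)/2⌋}, X_{⌈(a+b)/2⌉..b})`. -/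
noncomputable def delta (M L : ℕ → ℕ) (x : ℕ → ℝ) (a b : ℕ) : ℝ :=
  dHat M L x a ((a + b) / 2) ((a + b + 1) / 2) b

/-- The objective `d̂(X_{a-nα..t}, X_{t..b+nα})` of the single-change-point estimator in a sample
`x_1, …, x_n`; `nα` is rounded down, and indices outside `1..n` are clipped. -/
noncomputable def phiObjective (M L : ℕ → ℕ) (n : ℕ) (x : ℕ → ℝ) (α : ℝ) (a b t : ℕ) : ℝ :=
  dHat M L x (max 1 (a - ⌊(n : ℝ) * α⌋₊)) t t (min n (b + ⌊(n : ℝ) * α⌋₊))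

/-- `p` is a value of `Φ_x(a, b, α) = argmax_{t ∈ a..b} d̂(X_{a-nα..t}, X_{t..b+nα})`
(ties may be broken in any way). -/
def IsPhi (M L : ℕ → ℕ) (n : ℕ) (x : ℕ → ℝ) (α : ℝ) (a b p : ℕ) : Prop :=
  p ∈ Finset.Icc a b ∧
    ∀ t ∈ Finset.Icc a b, phiObjective M L n x α a b t ≤ phiObjective M L n x α a b p

/-! ### The multiple-change-point algorithm -/

/-- The step `α_j = λ_j / 3`, where `λ_j = 2 ^ (-j)`. -/
noncomputable def step (j : ℕ) : ℝ := (1 / 2) ^ j / 3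

/-- The index `⌊1/α_j - 1/(t+1)⌋` of the last boundary of the grid `(t, j)`. -/
noncomputable def gridSize (t j : ℕ) : ℕ := ⌊1 / step j - 1 / ((t : ℝ) + 1)⌋₊

/-- The boundary `b_i^{t,j} = n α_j (i + 1/(t+1))`, rounded down to a position in `1..n`. -/
noncomputable def boundary (n t j i : ℕ) : ℕ :=
  max 1 ⌊(n : ℝ) * step j * ((i : ℝ) + 1 / ((t : ℝ) + 1))⌋₊

/-- The `κ`-th highest (with multiplicity) of the values `d 1, …, d N`, that is, the largest `u`
such that at least `κ` of the values are `≥ u`; it is `0` if there are fewer than `κ` values. -/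
noncomputable def kthHighest (κ N : ℕ) (d : ℕ → ℝ) : ℝ :=
  sSup {u : ℝ | κ ≤ ((Finset.Icc 1 N).filter fun i => u ≤ d i).card}

/-- `γ_l`: the `κ`-th highest of the scores of the consecutive segments
`(b_{l+3(i-1)}, b_{l+3i})` of length three steps, `i = 1..⌊(gridSize - l)/3⌋`. -/
noncomputable def gammaPart (M L : ℕ → ℕ) (κ n : ℕ) (x : ℕ → ℝ) (t j l : ℕ) : ℝ :=
  kthHighest κ ((gridSize t j - l) / 3) fun i =>
    delta M L x (boundary n t j (l + 3 * (i - 1))) (boundary n t j (l + 3 * i))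

/-- The performance score `γ(t, j) = min_{l = 0..2} γ_l` of the grid `(t, j)`. -/
noncomputable def gamma (M L : ℕ → ℕ) (κ n : ℕ) (x : ℕ → ℝ) (t j : ℕ) : ℝ :=
  min (min (gammaPart M L κ n x t j 0) (gammaPart M L κ n x t j 1)) (gammaPart M L κ n x t j 2)

/-- The score `Δ_x(b_i, b_{i+1})` of the `i`-th segment of the grid `(t, j)`. -/
noncomputable def cellScore (M L : ℕ → ℕ) (n : ℕ) (x : ℕ → ℝ) (t j i : ℕ) : ℝ :=
  delta M L x (boundary n t j i) (boundary n t j (i + 1))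

/-- `p` is a vector of candidate change points `π̂_k^{t,j}`, `k = 1..κ`, of the grid `(t, j)`:
`κ` segments `(b_i, b_{i+1})` of highest score are selected (ties broken in any way), they are
listed from left to right, and `p k` is the single-change-point estimate in the `k`-th of them.
If the grid has fewer than `κ` segments nothing is required: then `γ(t, j) = 0` and the grid does
not contribute to the estimates. -/
def IsCandidate (M L : ℕ → ℕ) (κ n : ℕ) (x : ℕ → ℝ) (t j : ℕ) (p : Fin κ → ℕ) : Prop :=
  κ ≤ gridSize t j → ∃ s : Fin κ → ℕ,
    StrictMono s ∧ (∀ k, s k < gridSize t j) ∧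
    (∀ i < gridSize t j, i ∉ Set.range s →
      ∀ k, cellScore M L n x t j i ≤ cellScore M L n x t j (s k)) ∧
    ∀ k, IsPhi M L n x (step j) (boundary n t j (s k)) (boundary n t j (s k + 1)) (p k)

/-- The sum of weights `η = ∑_{j=1}^{log₂ n} ∑_{t=1}^{κ+1} w_j γ(t, j)`, with `w_j = 2 ^ (-j)`. -/
noncomputable def eta (M L : ℕ → ℕ) (κ n : ℕ) (x : ℕ → ℝ) : ℝ :=
  ∑ j ∈ Finset.Icc 1 (Nat.log 2 n), ∑ t ∈ Finset.Icc 1 (κ + 1),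
    (1 / 2 : ℝ) ^ j * gamma M L κ n x t j

/-- `est` is an output `(θ̂_1, …, θ̂_κ)` of the algorithm with input `x_1, …, x_n` and `κ`. -/
def IsOutput (M L : ℕ → ℕ) (κ n : ℕ) (x : ℕ → ℝ) (est : Fin κ → ℝ) : Prop :=
  ∃ p : ℕ → ℕ → Fin κ → ℕ,
    (∀ j ∈ Finset.Icc 1 (Nat.log 2 n), ∀ t ∈ Finset.Icc 1 (κ + 1),
      IsCandidate M L κ n x t j (p t j)) ∧
    ∀ k, est k = 1 / ((n : ℝ) * eta M L κ n x) *
      ∑ j ∈ Finset.Icc 1 (Nat.log 2 n), ∑ t ∈ Finset.Icc 1 (κ + 1),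
        (1 / 2 : ℝ) ^ j * gamma M L κ n x t j * (p t j k : ℝ)

/-! ### The data -/

/-- The change point `⌊n θ_k⌋`, for `k = 0, …, κ + 1`. -/
noncomputable def changePoint {κ : ℕ} (θ : Fin (κ + 2) → ℝ) (n : ℕ) (k : Fin (κ + 2)) : ℕ :=
  ⌊(n : ℝ) * θ k⌋₊

/-- The sample `x_1, …, x_n`: the concatenation of `κ + 1` segments, the `r`-th of which occupies
the positions `⌊n θ_r⌋ + 1, …, ⌊n θ_{r+1}⌋` and consists of the first elements
`Y r 0, Y r 1, …` of the `r`-th row. (At each position `1..n` exactly one summand is active.) -/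
noncomputable def sample {κ : ℕ} (θ : Fin (κ + 2) → ℝ) (n : ℕ) (Y : Fin (κ + 1) → ℕ → ℝ) :
    ℕ → ℝ := fun i =>
  ∑ r : Fin (κ + 1),
    if changePoint θ n r.castSucc < i ∧ i ≤ changePoint θ n r.succ then
      Y r (i - changePoint θ n r.castSucc - 1) else 0

/-! ### The algorithm always has an output -/

theorem boundary_mono (n t j i : ℕ) : boundary n t j i ≤ boundary n t j (i + 1) := by
  unfold boundary step
  gcongr
  simp

/-- Among `N ≥ κ` values there are `κ` highest ones. -/
theorem exists_top (N : ℕ) (d : ℕ → ℝ) (κ : ℕ) (h : κ ≤ N) :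
    ∃ s : Fin κ → ℕ, StrictMono s ∧ (∀ k, s k < N) ∧
      ∀ i < N, i ∉ Set.range s → ∀ k, d i ≤ d (s k) := by
  have key : ∃ S : Finset ℕ, S ⊆ Finset.range N ∧ S.card = κ ∧
      ∀ i < N, i ∉ S → ∀ k ∈ S, d i ≤ d k := by
    induction κ with
    | zero => exact ⟨∅, by simp⟩
    | succ κ ih =>
      obtain ⟨S, hS, hc, hd⟩ := ih (by omega)
      have hne : (Finset.range N \ S).Nonempty := by
        rw [← Finset.card_pos, Finset.card_sdiff_of_subset hS, Finset.card_range]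
        omega
      obtain ⟨a, ha, hmax⟩ := Finset.exists_max_image _ d hne
      simp only [Finset.mem_sdiff, Finset.mem_range] at ha hmax
      refine ⟨insert a S, ?_, ?_, ?_⟩
      · intro i hi
        rcases Finset.mem_insert.1 hi with rfl | hi
        · simpa using ha.1
        · exact hS hi
      · rw [Finset.card_insert_of_notMem ha.2, hc]
      · intro i hi hiS k hk
        rw [Finset.mem_insert, not_or] at hiS
        rcases Finset.mem_insert.1 hk with rfl | hk
        · exact hmax i ⟨hi, hiS.2⟩
        · exact hd i hi hiS.2 k hk
  obtain ⟨S, hS, hc, hd⟩ := key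
  refine ⟨S.orderEmbOfFin hc, (S.orderEmbOfFin hc).strictMono, fun k => ?_, fun i hi hiS k => ?_⟩
  · exact Finset.mem_range.1 (hS (S.orderEmbOfFin_mem hc k))
  · rw [Finset.range_orderEmbOfFin] at hiS
    exact hd i hi (by simpa using hiS) _ (S.orderEmbOfFin_mem hc k)

theorem exists_isPhi (M L : ℕ → ℕ) (n : ℕ) (x : ℕ → ℝ) (α : ℝ) (a b : ℕ) (h : a ≤ b) :
    ∃ p, IsPhi M L n x α a b p := by
  obtain ⟨p, hp, hmax⟩ := Finset.exists_max_image (Finset.Icc a b) (phiObjective M L n x α a b)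
    (Finset.nonempty_Icc.2 h)
  exact ⟨p, hp, hmax⟩

theorem exists_isOutput (M L : ℕ → ℕ) (κ n : ℕ) (x : ℕ → ℝ) :
    ∃ est : Fin κ → ℝ, IsOutput M L κ n x est := by
  have h : ∀ t j : ℕ, ∃ p : Fin κ → ℕ, IsCandidate M L κ n x t j p := by
    intro t j
    by_cases hN : κ ≤ gridSize t j
    · obtain ⟨s, h1, h2, h3⟩ := exists_top (gridSize t j) (cellScore M L n x t j) κ hN
      choose p hp using fun k : Fin κ => exists_isPhi M L n x (step j)
        (boundary n t j (s k)) (boundary n t j (s k + 1)) (boundary_mono n t j (s k))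
      exact ⟨p, fun _ => ⟨s, h1, h2, h3, hp⟩⟩
    · exact ⟨0, fun h => absurd h hN⟩
  choose p hp using h
  exact ⟨_, p, fun j _ t _ => hp t j, fun k => rfl⟩

end ChangePoint

/-!
The empirical distance is a truncation of the distributional distance
`D(ρ, ρ') = ∑ w_m w_l ∑_B |ρ B - ρ' B|`, and asymptotically it measures exactly that. In a stretch
of the sample between the relative positions `u < v` the frequency of every cube converges to its
probability under the mixture of the row laws in the proportions in which the rows occupy `(u, v)`
(`IsTypical.tendsto_freq_sample`: prefix counts of the sample are sums of prefix counts of the rows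
up to a bounded error). Scheffé's lemma makes this convergence uniform over the cubes of one
partition, and dominated convergence in the weights `w_m w_l` gives the convergence of `dHat` to the
distance of the two mixtures (`IsTypical.tendsto_dHat`). Since the limit statements hold along every
filter finer than `atTop`, no uniformity in the end points is needed: maximizers are treated by
passing to ultrafilters.

If a window contains no change point, both halves have the same limit law and its score tends to
`0`. If it contains exactly one, splitting it at `w` gives two mixtures whose distance is
`contrast u v s w` times the distance of the two neighbouring laws; the latter is positive because
cubes determine a law (`ext_of_real_cube`), and the factor has its unique maximum at the change
point. Hence the scores of such segments stay positive and `IsPhi` is consistent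
(`IsTypical.tendsto_of_isPhi`).

For a fixed grid there are two cases. If for one of the three offsets fewer than `κ` of the
segments of three steps have a nonzero limit score, then `γ(t, j)` tends to `0`. Otherwise, for each
offset, the `κ` change points lie in the interiors of `κ` different segments of three steps. Using
all three offsets, no change point is a grid point, and the cells of different change points are so
far apart that every window of three cells contains at most one. Therefore the selected cells are
eventually the cells of the change points and the candidates converge to the change points
(`IsTypical.tendsto_candidate`). In both cases the contribution of the grid to the error vanishes
(`IsTypical.tendsto_gamma_mul_abs`).

Grids with large `j` have small weight, so dominated convergence in `j` lets the total weighted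
error tend to `0`. The normalization `η` stays away from zero since some grid is of the second kind:
for a step much smaller than the gaps between the change points, these cannot meet all the `κ + 1`
grids of that step, as the positions of two such grids never coincide
(`IsTypical.exists_isSeparating`).
-/

namespace ChangePoint

/-! ### Counting the occurrences of a cube -/

/-- The number of positions `i < s` at which the block `(x_i, …, x_{i+m-1})` lies in `B`. -/
noncomputable def hits (x : ℕ → ℝ) {m : ℕ} (B : Set (Fin m → ℝ)) (s : ℕ) : ℝ :=
  ∑ i ∈ Finset.range s, B.indicator (fun _ => (1 : ℝ)) (block x m i)

theorem indicator_one_mem_Icc {α : Type*} (B : Set α) (y : α) :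
    B.indicator (fun _ => (1 : ℝ)) y ∈ Set.Icc (0 : ℝ) 1 := by
  by_cases h : y ∈ B <;> simp [h]

theorem hits_nonneg (x : ℕ → ℝ) {m : ℕ} (B : Set (Fin m → ℝ)) (s : ℕ) : 0 ≤ hits x B s :=
  Finset.sum_nonneg fun _ _ => (indicator_one_mem_Icc _ _).1

theorem hits_le (x : ℕ → ℝ) {m : ℕ} (B : Set (Fin m → ℝ)) (s : ℕ) : hits x B s ≤ s := by
  calc hits x B s ≤ ∑ i ∈ Finset.range s, (1 : ℝ) :=
        Finset.sum_le_sum fun _ _ => (indicator_one_mem_Icc _ _).2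
    _ = s := by simp

theorem hits_add (x : ℕ → ℝ) {m : ℕ} (B : Set (Fin m → ℝ)) (s d : ℕ) :
    hits x B (s + d) = hits x B s +
      ∑ i ∈ Finset.range d, B.indicator (fun _ => (1 : ℝ)) (block x m (s + i)) := by
  unfold hits
  rw [Finset.sum_range_add]

theorem freq_eq_sum {x : ℕ → ℝ} {a b m : ℕ} (h : m ≤ b + 1 - a) (B : Set (Fin m → ℝ)) :
    freq x a b B = (∑ i ∈ Finset.Icc a (b + 1 - m), B.indicator (fun _ => (1 : ℝ)) (block x m i)) /
      ((b + 1 - a - m + 1 : ℕ) : ℝ) := by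
  classical
  rw [freq, if_pos h, Finset.natCast_card_filter]
  congr 1

theorem freq_eq_hits {x : ℕ → ℝ} {a b m : ℕ} (hab : a ≤ b) (h : m ≤ b + 1 - a)
    (B : Set (Fin m → ℝ)) :
    freq x a b B = (hits x B (b + 2 - m) - hits x B a) / ((b : ℝ) + 2 - m - a) := by
  obtain ⟨d, hd⟩ : ∃ d, b + 2 - m = a + d := ⟨b + 2 - m - a, by omega⟩
  rw [freq_eq_sum h, hd, hits_add, add_sub_cancel_left]
  congr 1
  · have : Finset.Icc a (b + 1 - m) = Finset.Ico a (a + d) := by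
      ext i; simp only [Finset.mem_Icc, Finset.mem_Ico]; omega
    rw [this, Finset.sum_Ico_eq_sum_range]
    simp
  · have : b + 1 - a - m + 1 + a + m = b + 2 := by omega
    have h2 : ((b + 1 - a - m + 1 : ℕ) : ℝ) + a + m = b + 2 := by exact_mod_cast this
    linarith

theorem tendsto_hits_div_self {y : ℕ → ℝ} {m : ℕ} {B : Set (Fin m → ℝ)} {ρ : ℝ}
    (h : Tendsto (fun n : ℕ => freq y 0 n B) atTop (𝓝 ρ)) :
    Tendsto (fun q : ℕ => hits y B q / q) atTop (𝓝 ρ) := by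
  have h1 : Tendsto (fun q : ℕ => q + m - 2) atTop atTop :=
    tendsto_atTop_atTop.2 fun b => ⟨b + 2, fun a ha => by omega⟩
  refine (h.comp h1).congr' ?_
  filter_upwards [eventually_ge_atTop 2] with q hq
  have h2 : q + m - 2 + 2 - m = q := by omega
  have h3 : ((q + m - 2 : ℕ) : ℝ) = q + m - 2 := by
    rw [Nat.cast_sub (by omega)]; push_cast; ring
  simp only [Function.comp]
  rw [freq_eq_hits (Nat.zero_le _) (by omega), h2, h3]
  simp [hits]

/-- Along a sequence of prefix lengths `e n ∼ w n` the number of hits is `∼ w ρ n`. -/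
theorem tendsto_hits_div {y : ℕ → ℝ} {m : ℕ} {B : Set (Fin m → ℝ)} {ρ w : ℝ}
    (h : Tendsto (fun n : ℕ => freq y 0 n B) atTop (𝓝 ρ)) {F : Filter ℕ} (hF : F ≤ atTop)
    {e : ℕ → ℕ} (he : Tendsto (fun n => (e n : ℝ) / n) F (𝓝 w)) :
    Tendsto (fun n => hits y B (e n) / n) F (𝓝 (w * ρ)) := by
  rcases F.eq_or_neBot with rfl | hne
  · exact tendsto_bot
  have hw : 0 ≤ w := ge_of_tendsto' he fun n => by positivity
  rcases hw.eq_or_lt with rfl | hw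
  · rw [zero_mul]
    refine squeeze_zero (fun n => div_nonneg (hits_nonneg _ _ _) (by positivity)) (fun n => ?_) he
    gcongr
    exact hits_le _ _ _
  · have hn : Tendsto (fun n : ℕ => (n : ℝ)) F atTop := tendsto_natCast_atTop_atTop.mono_left hF
    have he' : Tendsto e F atTop := by
      rw [← tendsto_natCast_atTop_iff (R := ℝ)]
      refine (he.pos_mul_atTop hw hn).congr' ?_
      filter_upwards [hF (eventually_gt_atTop 0)] with n hn
      field_simp
    refine (he.mul ((tendsto_hits_div_self h).comp he')).congr' ?_
    filter_upwards [he' (eventually_gt_atTop 0), hF (eventually_gt_atTop 0)] with n h1 h2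
    have h1 : 0 < e n := h1
    simp only [Function.comp]
    field_simp

/-! ### The sample as a concatenation of prefixes of the rows -/

theorem changePoint_mono {κ : ℕ} {θ : Fin (κ + 2) → ℝ} (hθ : StrictMono θ) (n : ℕ) :
    Monotone (changePoint θ n) := fun _ _ h =>
  Nat.floor_mono (mul_le_mul_of_nonneg_left (hθ.monotone h) (Nat.cast_nonneg n))

theorem tendsto_nat_floor_mul_div {c : ℝ} (hc : 0 ≤ c) {F : Filter ℕ} (hF : F ≤ atTop) :
    Tendsto (fun n : ℕ => ((⌊(n : ℝ) * c⌋₊ : ℕ) : ℝ) / n) F (𝓝 c) := by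
  have h := (tendsto_nat_floor_mul_div_atTop (R := ℝ) hc).comp tendsto_natCast_atTop_atTop
  refine (h.mono_left hF).congr fun n => ?_
  simp [mul_comm]

theorem sample_apply {κ : ℕ} {θ : Fin (κ + 2) → ℝ} (hθ : StrictMono θ) (n : ℕ)
    (Y : Fin (κ + 1) → ℕ → ℝ) (r : Fin (κ + 1)) {i : ℕ}
    (h : changePoint θ n r.castSucc + 1 + i ≤ changePoint θ n r.succ) :
    sample θ n Y (changePoint θ n r.castSucc + 1 + i) = Y r i := by
  unfold sample
  rw [Finset.sum_eq_single r]
  · rw [if_pos ⟨by omega, h⟩]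
    congr 1
    omega
  · intro r' _ hr'
    rw [if_neg]
    rintro ⟨h1, h2⟩
    rcases lt_or_gt_of_ne hr' with hlt | hlt
    · have := changePoint_mono hθ n (Fin.succ_le_castSucc_iff.2 hlt)
      omega
    · have := changePoint_mono hθ n (Fin.succ_le_castSucc_iff.2 hlt)
      omega
  · simp

/-- Between two consecutive change points the sample has, up to the at most `m` blocks that stick
out of the segment, the hits of the row. -/
theorem abs_hits_sample_sub_le {κ : ℕ} {θ : Fin (κ + 2) → ℝ} (hθ : StrictMono θ) (n : ℕ)
    (Y : Fin (κ + 1) → ℕ → ℝ) {m : ℕ} (B : Set (Fin m → ℝ)) (s : ℕ) (r : Fin (κ + 1)) :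
    |hits (sample θ n Y) B (min s (changePoint θ n r.succ + 1)) -
        hits (sample θ n Y) B (min s (changePoint θ n r.castSucc + 1)) -
        hits (Y r) B (min s (changePoint θ n r.succ + 1) -
          min s (changePoint θ n r.castSucc + 1))| ≤ m := by
  have hmono := changePoint_mono hθ n (Fin.castSucc_lt_succ (i := r)).le
  obtain ⟨d, hd⟩ : ∃ d, min s (changePoint θ n r.succ + 1) =
      min s (changePoint θ n r.castSucc + 1) + d :=
    ⟨_, (Nat.add_sub_of_le (by omega)).symm⟩
  rw [hd, hits_add, add_sub_cancel_left, Nat.add_sub_cancel_left, hits, ← Finset.sum_sub_distrib]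
  calc _ ≤ ∑ i ∈ Finset.range d, if d < i + m then (1 : ℝ) else 0 := by
        refine (Finset.abs_sum_le_sum_abs _ _).trans (Finset.sum_le_sum fun i hi => ?_)
        rw [Finset.mem_range] at hi
        split_ifs with h
        · have h1 := indicator_one_mem_Icc B
            (block (sample θ n Y) m (min s (changePoint θ n r.castSucc + 1) + i))
          have h2 := indicator_one_mem_Icc B (block (Y r) m i)
          rw [abs_le]
          constructor <;> linarith [h1.1, h1.2, h2.1, h2.2]
        · have : block (sample θ n Y) m (min s (changePoint θ n r.castSucc + 1) + i) =
              block (Y r) m i := by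
            funext q
            have hq := q.2
            have h1 : min s (changePoint θ n r.castSucc + 1) = changePoint θ n r.castSucc + 1 := by
              omega
            simp only [block]
            rw [h1, add_assoc]
            exact sample_apply hθ n Y r (by omega)
          simp [this]
    _ = (((Finset.range d).filter fun i => d < i + m).card : ℝ) := by
        rw [Finset.natCast_card_filter]
    _ ≤ ((Finset.Ico (d - m) d).card : ℝ) := by
        gcongr
        intro i
        simp only [Finset.mem_filter, Finset.mem_range, Finset.mem_Ico]
        omega
    _ ≤ m := by
        rw [Nat.card_Ico]
        exact_mod_cast (by omega : d - (d - m) ≤ m)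

theorem sum_succ_sub_castSucc {N : ℕ} (f : Fin (N + 1) → ℝ) :
    ∑ r : Fin N, (f r.succ - f r.castSucc) = f (Fin.last N) - f 0 := by
  have h1 := Fin.sum_univ_succ f
  have h2 := Fin.sum_univ_castSucc f
  rw [Finset.sum_sub_distrib]
  linarith

/-- A row-indexed family of mass functions `ρ r m l c`: the probability that row `r` gives to the
cube of `B^{m,l}` with index `c`. -/
abbrev Masses : Type := ∀ m : ℕ, ℕ → (Fin m → ℤ) → ℝ

/-- The situation in which the sample path behaves as it does almost surely: the change points
increase from `0` to `1`, the mass functions `ρ r` of the rows have total mass one and differ for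
consecutive rows, and the frequencies in each row `Y r` converge to `ρ r`. -/
structure IsTypical {κ : ℕ} (θ : Fin (κ + 2) → ℝ) (Y : Fin (κ + 1) → ℕ → ℝ)
    (ρ : Fin (κ + 1) → Masses) : Prop where
  zero : θ 0 = 0
  one : θ (Fin.last (κ + 1)) = 1
  strictMono : StrictMono θ
  nonneg : ∀ r m l c, 0 ≤ ρ r m l c
  hasSum : ∀ r m l, HasSum (ρ r m l) 1
  tendsto : ∀ r m l c, Tendsto (fun n : ℕ => freq (Y r) 0 n (cube l c)) atTop (𝓝 (ρ r m l c))
  ne : ∀ k : Fin κ, ∃ m l, 1 ≤ m ∧ 1 ≤ l ∧ ρ k.castSucc m l ≠ ρ k.succ m l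

/-- The limiting share of hits in the sample up to relative position `w`. -/
noncomputable def cumulative {κ : ℕ} (θ : Fin (κ + 2) → ℝ) (ρ : Fin (κ + 1) → Masses) (w : ℝ) :
    Masses := fun m l c =>
  ∑ r : Fin (κ + 1), (min w (θ r.succ) - min w (θ r.castSucc)) * ρ r m l c

/-- The mixture of the laws of the rows that the part of the sample between the relative positions
`u` and `v` is asymptotically distributed by. -/
noncomputable def mixture {κ : ℕ} (θ : Fin (κ + 2) → ℝ) (ρ : Fin (κ + 1) → Masses) (u v : ℝ) :
    Masses := fun m l c => (cumulative θ ρ v m l c - cumulative θ ρ u m l c) / (v - u)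

section Typical

variable {κ : ℕ} {θ : Fin (κ + 2) → ℝ} {Y : Fin (κ + 1) → ℕ → ℝ} {ρ : Fin (κ + 1) → Masses}

theorem IsTypical.mem_Icc (H : IsTypical θ Y ρ) (r : Fin (κ + 2)) : θ r ∈ Set.Icc (0 : ℝ) 1 :=
  ⟨H.zero ▸ H.strictMono.monotone (Fin.zero_le r), H.one ▸ H.strictMono.monotone (Fin.le_last r)⟩

theorem IsTypical.tendsto_hits_sample (H : IsTypical θ Y ρ) {F : Filter ℕ} (hF : F ≤ atTop)
    {s : ℕ → ℕ} {w : ℝ} (hw : w ≤ 1) (hs : Tendsto (fun n => (s n : ℝ) / n) F (𝓝 w))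
    (m l : ℕ) (c : Fin m → ℤ) :
    Tendsto (fun n => hits (sample θ n Y) (cube l c) (s n) / n) F
      (𝓝 (cumulative θ ρ w m l c)) := by
  rcases F.eq_or_neBot with rfl | hne
  · exact tendsto_bot
  have hw0 : 0 ≤ w := ge_of_tendsto' hs fun n => by positivity
  set e : Fin (κ + 2) → ℕ → ℕ := fun q n => min (s n) (changePoint θ n q + 1) with he
  have hinv : Tendsto (fun n : ℕ => (1 : ℝ) / n) F (𝓝 0) :=
    tendsto_one_div_atTop_nhds_zero_nat.mono_left hF
  have hcp : ∀ q, Tendsto (fun n => (e q n : ℝ) / n) F (𝓝 (min w (θ q))) := by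
    intro q
    have h1 := (tendsto_nat_floor_mul_div (H.mem_Icc q).1 hF).add hinv
    rw [add_zero] at h1
    refine (hs.min h1).congr fun n => ?_
    simp only [he, changePoint]
    push_cast
    rw [← add_div, min_div_div_right (Nat.cast_nonneg n)]
  have hd : ∀ r : Fin (κ + 1), Tendsto
      (fun n => ((e r.succ n - e r.castSucc n : ℕ) : ℝ) / n) F
      (𝓝 (min w (θ r.succ) - min w (θ r.castSucc))) := by
    intro r
    refine ((hcp r.succ).sub (hcp r.castSucc)).congr fun n => ?_
    have := changePoint_mono H.strictMono n (Fin.castSucc_lt_succ (i := r)).le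
    rw [Nat.cast_sub (by simp only [he]; omega), sub_div]
  have hrow := tendsto_finsetSum Finset.univ fun r (_ : r ∈ Finset.univ) =>
    tendsto_hits_div (H.tendsto r m l c) hF (hd r)
  have hle : ∀ q n, e q n ≤ s n := fun q n => min_le_left _ _
  have herr : Tendsto (fun n => ((s n : ℝ) / n - (e (Fin.last _) n : ℝ) / n) +
      ((κ + 1) * m) * (1 / (n : ℝ)) + (e 0 n : ℝ) / n) F (𝓝 0) := by
    have h := ((hs.sub (hcp (Fin.last _))).add (hinv.const_mul ((κ + 1 : ℝ) * m))).add (hcp 0)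
    rwa [H.zero, H.one, min_eq_left hw, min_eq_right hw0, sub_self, mul_zero, add_zero,
      add_zero] at h
  have hdiff : Tendsto (fun n => hits (sample θ n Y) (cube l c) (s n) / n -
      ∑ r : Fin (κ + 1), hits (Y r) (cube l c) (e r.succ n - e r.castSucc n) / n) F (𝓝 0) := by
    refine squeeze_zero_norm (fun n => ?_) herr
    have h1 : ∀ r : Fin (κ + 1), |hits (sample θ n Y) (cube l c) (e r.succ n) -
        hits (sample θ n Y) (cube l c) (e r.castSucc n) -
        hits (Y r) (cube l c) (e r.succ n - e r.castSucc n)| ≤ m := fun r =>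
      abs_hits_sample_sub_le H.strictMono n Y (cube l c) (s n) r
    have h2 := (Finset.abs_sum_le_sum_abs _ Finset.univ).trans
      (Finset.sum_le_sum fun r (_ : r ∈ Finset.univ) => h1 r)
    rw [Finset.sum_sub_distrib,
      sum_succ_sub_castSucc fun q => hits (sample θ n Y) (cube l c) (e q n)] at h2
    simp only [Finset.sum_const, Finset.card_univ, Fintype.card_fin, nsmul_eq_mul] at h2
    have h3 : |hits (sample θ n Y) (cube l c) (s n) -
        hits (sample θ n Y) (cube l c) (e (Fin.last _) n)| ≤ s n - e (Fin.last _) n := by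
      obtain ⟨d, hd⟩ := Nat.exists_eq_add_of_le (hle (Fin.last _) n)
      rw [hd, hits_add, add_sub_cancel_left, abs_of_nonneg
        (Finset.sum_nonneg fun _ _ => (indicator_one_mem_Icc _ _).1)]
      refine (Finset.sum_le_sum fun _ _ => (indicator_one_mem_Icc _ _).2).trans ?_
      simp
    have h4 := hits_nonneg (sample θ n Y) (cube l c) (e 0 n)
    have h5 := hits_le (sample θ n Y) (cube l c) (e 0 n)
    rw [← Finset.sum_div, ← sub_div, ← sub_div, norm_div, Real.norm_natCast, Real.norm_eq_abs,
      mul_one_div, ← add_div, ← add_div]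
    gcongr
    push_cast at h2
    rw [abs_le] at h2 h3 ⊢
    constructor <;> linarith [h2.1, h2.2, h3.1, h3.2]
  have := hdiff.add hrow
  rw [zero_add] at this
  exact this.congr fun n => by ring

theorem eventually_add_le {F : Filter ℕ} (hF : F ≤ atTop) {a b : ℕ → ℕ} {u v : ℝ} (huv : u < v)
    (ha : Tendsto (fun n => (a n : ℝ) / n) F (𝓝 u))
    (hb : Tendsto (fun n => (b n : ℝ) / n) F (𝓝 v)) (K : ℕ) :
    ∀ᶠ n in F, a n + K ≤ b n := by
  have hinv : Tendsto (fun n : ℕ => 1 / (n : ℝ)) F (𝓝 0) :=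
    tendsto_one_div_atTop_nhds_zero_nat.mono_left hF
  have h := ha.add (hinv.const_mul (K : ℝ))
  rw [mul_zero, add_zero] at h
  filter_upwards [h.eventually_lt hb huv, hF (eventually_gt_atTop 0)] with n h1 h2
  rw [mul_one_div, ← add_div, div_lt_div_iff_of_pos_right (by exact_mod_cast h2)] at h1
  exact_mod_cast h1.le

theorem IsTypical.tendsto_freq_sample (H : IsTypical θ Y ρ) {F : Filter ℕ} (hF : F ≤ atTop)
    {a b : ℕ → ℕ} {u v : ℝ} (huv : u < v) (hv : v ≤ 1)
    (ha : Tendsto (fun n => (a n : ℝ) / n) F (𝓝 u))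
    (hb : Tendsto (fun n => (b n : ℝ) / n) F (𝓝 v)) (m l : ℕ) (c : Fin m → ℤ) :
    Tendsto (fun n => freq (sample θ n Y) (a n) (b n) (cube l c)) F
      (𝓝 (mixture θ ρ u v m l c)) := by
  have hinv : Tendsto (fun n : ℕ => 1 / (n : ℝ)) F (𝓝 0) :=
    tendsto_one_div_atTop_nhds_zero_nat.mono_left hF
  have hev := eventually_add_le hF huv ha hb m
  have hb' : Tendsto (fun n => ((b n + 2 - m : ℕ) : ℝ) / n) F (𝓝 v) := by
    have h := hb.add (hinv.const_mul (2 - m : ℝ))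
    rw [mul_zero, add_zero] at h
    refine h.congr' ?_
    filter_upwards [hev] with n hn
    rw [Nat.cast_sub (by omega)]
    push_cast
    ring
  have h1 := (H.tendsto_hits_sample hF hv hb' m l c).sub
    (H.tendsto_hits_sample hF (huv.le.trans hv) ha m l c)
  refine (h1.div (hb'.sub ha) (sub_pos.2 huv).ne').congr' ?_
  filter_upwards [hev, hF (eventually_gt_atTop 0)] with n hn hn0
  have hn0' : (n : ℝ) ≠ 0 := by exact_mod_cast hn0.ne'
  simp only [Pi.div_apply]
  rw [freq_eq_hits (by omega) (by omega), ← sub_div, ← sub_div, div_div_div_cancel_right₀ hn0',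
    Nat.cast_sub (by omega)]
  push_cast
  rfl

/-! ### Summation over all cubes -/

theorem freq_nonneg (x : ℕ → ℝ) (a b : ℕ) {m : ℕ} (B : Set (Fin m → ℝ)) : 0 ≤ freq x a b B := by
  unfold freq
  split_ifs <;> positivity

/-- The index of the cube of `B^{m,l}` that contains `y`. -/
noncomputable def cubeIndex {m : ℕ} (l : ℕ) (y : Fin m → ℝ) : Fin m → ℤ := fun r => ⌊y r * 2 ^ l⌋

theorem mem_cube_iff {m l : ℕ} {c : Fin m → ℤ} {y : Fin m → ℝ} :
    y ∈ cube l c ↔ c = cubeIndex l y := by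
  rw [eq_comm, funext_iff]
  refine forall_congr' fun r => ?_
  rw [cubeIndex, Int.floor_eq_iff, div_le_iff₀ (by positivity), lt_div_iff₀ (by positivity)]

theorem hasSum_freq {x : ℕ → ℝ} {a b m : ℕ} (h : m ≤ b + 1 - a) (hab : a ≤ b) (l : ℕ) :
    HasSum (fun c : Fin m → ℤ => freq x a b (cube l c)) 1 := by
  have h1 : HasSum (fun c : Fin m → ℤ => ∑ i ∈ Finset.Icc a (b + 1 - m),
      (cube l c).indicator (fun _ => (1 : ℝ)) (block x m i))
      (∑ i ∈ Finset.Icc a (b + 1 - m), 1) := by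
    refine hasSum_sum fun i _ => ?_
    convert hasSum_ite_eq (cubeIndex l (block x m i)) (1 : ℝ) using 2 with c
    classical
    rw [Set.indicator_apply]
    exact if_congr mem_cube_iff rfl rfl
  have h2 := h1.div_const ((b + 1 - a - m + 1 : ℕ) : ℝ)
  simp only [Finset.sum_const, Nat.card_Icc, nsmul_eq_mul, mul_one] at h2
  rw [show b + 1 - m + 1 - a = b + 1 - a - m + 1 by omega, div_self (by positivity)] at h2
  exact h2.congr_fun fun c => freq_eq_sum h _

theorem exists_hasSum_freq (x : ℕ → ℝ) (a b l : ℕ) {m : ℕ} (hm : 1 ≤ m) :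
    ∃ S ≤ (1 : ℝ), HasSum (fun c : Fin m → ℤ => freq x a b (cube l c)) S := by
  by_cases h : m ≤ b + 1 - a
  · exact ⟨1, le_rfl, hasSum_freq h (by omega) l⟩
  · refine ⟨0, zero_le_one, ?_⟩
    simp only [freq, h, if_false]
    exact hasSum_zero

theorem tsum_abs_freq_sub_freq_le (x : ℕ → ℝ) (a b a' b' l : ℕ) {m : ℕ} (hm : 1 ≤ m) :
    ∑' c : Fin m → ℤ, |freq x a b (cube l c) - freq x a' b' (cube l c)| ≤ 2 := by
  obtain ⟨S, hS, h⟩ := exists_hasSum_freq x a b l hm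
  obtain ⟨S', hS', h'⟩ := exists_hasSum_freq x a' b' l hm
  calc _ ≤ ∑' c : Fin m → ℤ, (freq x a b (cube l c) + freq x a' b' (cube l c)) := by
        refine (h.summable.sub h'.summable).abs.tsum_le_tsum (fun c => ?_)
          (h.summable.add h'.summable)
        have h1 := freq_nonneg x a b (cube l c)
        have h2 := freq_nonneg x a' b' (cube l c)
        rw [abs_le]
        constructor <;> linarith
    _ = S + S' := (h.add h').tsum_eq
    _ ≤ 2 := by linarith

/-- Scheffé's lemma for mass functions. -/
theorem tendsto_tsum_abs_sub {ι α : Type*} {F : Filter α} {f : α → ι → ℝ} {g : ι → ℝ}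
    (hf0 : ∀ n c, 0 ≤ f n c) (hf : ∀ᶠ n in F, HasSum (f n) 1) (hg0 : ∀ c, 0 ≤ g c)
    (hg : HasSum g 1) (h : ∀ c, Tendsto (f · c) F (𝓝 (g c))) :
    Tendsto (fun n => ∑' c, |f n c - g c|) F (𝓝 0) := by
  have h1 : Tendsto (fun n => ∑' c, max (g c - f n c) 0) F (𝓝 (∑' _ : ι, 0)) := by
    refine tendsto_tsum_of_dominated_convergence hg.summable (fun c => ?_) ?_
    · simpa using ((h c).const_sub (g c)).max (tendsto_const_nhds (x := (0 : ℝ)))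
    · refine Eventually.of_forall fun n c => ?_
      rw [Real.norm_of_nonneg (le_max_right _ _)]
      exact max_le (by linarith [hf0 n c]) (hg0 c)
  have h2 := h1.const_mul 2
  rw [tsum_zero, mul_zero] at h2
  refine h2.congr' ?_
  filter_upwards [hf] with n hn
  have h3 : Summable fun c => max (g c - f n c) 0 :=
    hg.summable.of_nonneg_of_le (fun c => le_max_right _ _)
      fun c => max_le (by linarith [hf0 n c]) (hg0 c)
  have h4 := (h3.hasSum.mul_left 2).add (hn.sub hg)
  rw [sub_self, add_zero] at h4
  rw [← h4.tsum_eq]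
  refine tsum_congr fun c => ?_
  rcases le_total (g c - f n c) 0 with h | h
  · rw [max_eq_right h, abs_of_nonneg (by linarith)]; ring
  · rw [max_eq_left h, abs_of_nonpos (by linarith)]; ring

theorem tendsto_tsum_abs_sub_sub {ι α : Type*} {F : Filter α} {f f' : α → ι → ℝ} {g g' : ι → ℝ}
    (hf0 : ∀ n c, 0 ≤ f n c) (hf : ∀ᶠ n in F, HasSum (f n) 1) (hg0 : ∀ c, 0 ≤ g c)
    (hg : HasSum g 1) (h : ∀ c, Tendsto (f · c) F (𝓝 (g c)))
    (hf0' : ∀ n c, 0 ≤ f' n c) (hf' : ∀ᶠ n in F, HasSum (f' n) 1) (hg0' : ∀ c, 0 ≤ g' c)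
    (hg' : HasSum g' 1) (h' : ∀ c, Tendsto (f' · c) F (𝓝 (g' c))) :
    Tendsto (fun n => ∑' c, |f n c - f' n c|) F (𝓝 (∑' c, |g c - g' c|)) := by
  rw [tendsto_iff_norm_sub_tendsto_zero]
  have h0 := (tendsto_tsum_abs_sub hf0 hf hg0 hg h).add (tendsto_tsum_abs_sub hf0' hf' hg0' hg' h')
  rw [add_zero] at h0
  refine squeeze_zero' (Eventually.of_forall fun _ => norm_nonneg _) ?_ h0
  filter_upwards [hf, hf'] with n hn hn'
  have s1 := (hn.summable.sub hn'.summable).abs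
  have s2 := (hg.summable.sub hg'.summable).abs
  have s3 := (hn.summable.sub hg.summable).abs
  have s4 := (hn'.summable.sub hg'.summable).abs
  rw [← s1.tsum_sub s2, ← s3.tsum_add s4]
  refine (norm_tsum_le_tsum_norm (s1.sub s2).norm).trans ?_
  refine (s1.sub s2).norm.tsum_le_tsum (fun c => ?_) (s3.add s4)
  rw [Real.norm_eq_abs]
  refine (abs_abs_sub_abs_le _ _).trans ?_
  rw [show f n c - f' n c - (g c - g' c) = (f n c - g c) - (f' n c - g' c) by ring]
  exact abs_sub _ _

/-! ### The limit of the empirical distance -/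

theorem weight_nonneg (j : ℕ) : 0 ≤ weight j := by unfold weight; positivity

theorem weight_zero : weight 0 = 0 := by simp [weight]

theorem hasSum_weight : HasSum weight 1 := by
  rw [hasSum_iff_tendsto_nat_of_nonneg weight_nonneg]
  have h : ∀ n : ℕ, ∑ j ∈ Finset.range (n + 1), weight j = 1 - 1 / ((n : ℝ) + 1) := by
    intro n
    induction n with
    | zero => simp [weight]
    | succ n ih =>
      rw [Finset.sum_range_succ, ih, weight]
      push_cast
      field_simp
      ring
  rw [← tendsto_add_atTop_iff_nat 1]
  simp_rw [h]
  simpa using (tendsto_one_div_add_atTop_nhds_zero_nat (𝕜 := ℝ)).const_sub 1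

theorem hasSum_weight_mul_weight :
    HasSum (fun p : ℕ × ℕ => weight p.1 * weight p.2) 1 := by
  have h := hasSum_weight.mul hasSum_weight
    (hasSum_weight.summable.mul_of_nonneg hasSum_weight.summable weight_nonneg weight_nonneg)
  rwa [one_mul] at h

/-- The distributional distance of two families of mass functions. -/
noncomputable def massDist (q q' : Masses) : ℝ :=
  ∑' p : ℕ × ℕ, weight p.1 * weight p.2 * ∑' c : Fin p.1 → ℤ, |q p.1 p.2 c - q' p.1 p.2 c|

theorem dHat_nonneg (M L : ℕ → ℕ) (x : ℕ → ℝ) (a b a' b' : ℕ) : 0 ≤ dHat M L x a b a' b' :=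
  Finset.sum_nonneg fun _ _ => Finset.sum_nonneg fun _ _ =>
    mul_nonneg (mul_nonneg (weight_nonneg _) (weight_nonneg _)) (tsum_nonneg fun _ => abs_nonneg _)

theorem dHat_le (M L : ℕ → ℕ) (x : ℕ → ℝ) (a b a' b' : ℕ) : dHat M L x a b a' b' ≤ 2 := by
  rw [dHat, ← Finset.sum_product']
  calc _ ≤ ∑ p ∈ Finset.Icc 1 (M (max (b + 1 - a) (b' + 1 - a'))) ×ˢ
        Finset.Icc 1 (L (max (b + 1 - a) (b' + 1 - a'))), weight p.1 * weight p.2 * 2 := by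
        refine Finset.sum_le_sum fun p hp => ?_
        rw [Finset.mem_product, Finset.mem_Icc] at hp
        exact mul_le_mul_of_nonneg_left (tsum_abs_freq_sub_freq_le x a b a' b' p.2 hp.1.1)
          (mul_nonneg (weight_nonneg _) (weight_nonneg _))
    _ ≤ 1 * 2 := sum_le_hasSum _ (fun p _ => by
        have := weight_nonneg p.1; have := weight_nonneg p.2; positivity)
        (hasSum_weight_mul_weight.mul_right 2)
    _ = 2 := one_mul 2

theorem mixture_nonneg (hθ : StrictMono θ) (hρ : ∀ r m l c, 0 ≤ ρ r m l c) {u v : ℝ}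
    (huv : u < v) (m l : ℕ) (c : Fin m → ℤ) : 0 ≤ mixture θ ρ u v m l c := by
  refine div_nonneg ?_ (sub_pos.2 huv).le
  rw [cumulative, cumulative, ← Finset.sum_sub_distrib]
  refine Finset.sum_nonneg fun r _ => ?_
  rw [← sub_mul]
  refine mul_nonneg ?_ (hρ r m l c)
  have h := hθ (Fin.castSucc_lt_succ (i := r))
  rcases min_cases v (θ r.succ) with h1 | h1 <;> rcases min_cases v (θ r.castSucc) with h2 | h2 <;>
  rcases min_cases u (θ r.succ) with h3 | h3 <;> rcases min_cases u (θ r.castSucc) with h4 | h4 <;>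
  linarith

theorem IsTypical.hasSum_cumulative (H : IsTypical θ Y ρ) {w : ℝ} (hw : w ∈ Set.Icc (0 : ℝ) 1)
    (m l : ℕ) : HasSum (cumulative θ ρ w m l) w := by
  have h := hasSum_sum fun r (_ : r ∈ Finset.univ) =>
    (H.hasSum r m l).mul_left (min w (θ r.succ) - min w (θ r.castSucc))
  simp only [mul_one] at h
  rwa [sum_succ_sub_castSucc fun q => min w (θ q), H.zero, H.one, min_eq_left hw.2,
    min_eq_right hw.1, sub_zero] at h

theorem IsTypical.hasSum_mixture (H : IsTypical θ Y ρ) {u v : ℝ} (hu : 0 ≤ u) (huv : u < v)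
    (hv : v ≤ 1) (m l : ℕ) : HasSum (mixture θ ρ u v m l) 1 := by
  have h := ((H.hasSum_cumulative ⟨hu.trans huv.le, hv⟩ m l).sub
    (H.hasSum_cumulative ⟨hu, huv.le.trans hv⟩ m l)).div_const (v - u)
  rwa [div_self (sub_pos.2 huv).ne'] at h

/-- The empirical distance of two growing parts of the sample converges to the distributional
distance of the corresponding mixtures. -/
theorem IsTypical.tendsto_dHat (H : IsTypical θ Y ρ) {M L : ℕ → ℕ} (hM : Tendsto M atTop atTop)
    (hL : Tendsto L atTop atTop) {F : Filter ℕ} (hF : F ≤ atTop)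
    {a b a' b' : ℕ → ℕ} {u v u' v' : ℝ} (huv : u < v) (hv : v ≤ 1) (huv' : u' < v') (hv' : v' ≤ 1)
    (ha : Tendsto (fun n => (a n : ℝ) / n) F (𝓝 u))
    (hb : Tendsto (fun n => (b n : ℝ) / n) F (𝓝 v))
    (ha' : Tendsto (fun n => (a' n : ℝ) / n) F (𝓝 u'))
    (hb' : Tendsto (fun n => (b' n : ℝ) / n) F (𝓝 v')) :
    Tendsto (fun n => dHat M L (sample θ n Y) (a n) (b n) (a' n) (b' n)) F
      (𝓝 (massDist (mixture θ ρ u v) (mixture θ ρ u' v'))) := by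
  rcases F.eq_or_neBot with rfl | hne
  · exact tendsto_bot
  have hu : 0 ≤ u := ge_of_tendsto' ha fun n => by positivity
  have hu' : 0 ≤ u' := ge_of_tendsto' ha' fun n => by positivity
  have hN : Tendsto (fun n => max (b n + 1 - a n) (b' n + 1 - a' n)) F atTop := by
    refine tendsto_atTop.2 fun K => ?_
    filter_upwards [eventually_add_le hF huv ha hb K] with n hn
    exact le_max_of_le_left (by omega)
  have hT : ∀ m l, Tendsto (fun n => ∑' c : Fin m → ℤ,
      |freq (sample θ n Y) (a n) (b n) (cube l c) - freq (sample θ n Y) (a' n) (b' n) (cube l c)|) F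
      (𝓝 (∑' c : Fin m → ℤ, |mixture θ ρ u v m l c - mixture θ ρ u' v' m l c|)) := by
    intro m l
    refine tendsto_tsum_abs_sub_sub (fun _ _ => freq_nonneg _ _ _ _) ?_
      (mixture_nonneg H.strictMono H.nonneg huv m l) (H.hasSum_mixture hu huv hv m l)
      (H.tendsto_freq_sample hF huv hv ha hb m l)
      (fun _ _ => freq_nonneg _ _ _ _) ?_
      (mixture_nonneg H.strictMono H.nonneg huv' m l) (H.hasSum_mixture hu' huv' hv' m l)
      (H.tendsto_freq_sample hF huv' hv' ha' hb' m l)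
    · filter_upwards [eventually_add_le hF huv ha hb m] with n hn
      exact hasSum_freq (by omega) (by omega) l
    · filter_upwards [eventually_add_le hF huv' ha' hb' m] with n hn
      exact hasSum_freq (by omega) (by omega) l
  classical
  have key := tendsto_tsum_of_dominated_convergence
    (f := fun n (p : ℕ × ℕ) => if p ∈ Finset.Icc 1 (M (max (b n + 1 - a n) (b' n + 1 - a' n))) ×ˢ
        Finset.Icc 1 (L (max (b n + 1 - a n) (b' n + 1 - a' n))) then
      weight p.1 * weight p.2 * ∑' c : Fin p.1 → ℤ, |freq (sample θ n Y) (a n) (b n) (cube p.2 c) -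
        freq (sample θ n Y) (a' n) (b' n) (cube p.2 c)| else 0)
    (g := fun p => weight p.1 * weight p.2 *
      ∑' c : Fin p.1 → ℤ, |mixture θ ρ u v p.1 p.2 c - mixture θ ρ u' v' p.1 p.2 c|)
    (𝓕 := F) (hasSum_weight_mul_weight.mul_right 2).summable ?_ ?_
  · refine key.congr fun n => ?_
    rw [dHat, ← Finset.sum_product', tsum_eq_sum (fun p hp => if_neg hp)]
    exact Finset.sum_congr rfl fun p hp => if_pos hp
  · rintro ⟨m, l⟩
    by_cases h0 : m = 0 ∨ l = 0
    · have : weight m * weight l = 0 := by rcases h0 with rfl | rfl <;> simp [weight_zero]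
      simp [this]
    · refine ((hT m l).const_mul (weight m * weight l)).congr' ?_
      filter_upwards [hN.eventually (hM.eventually_ge_atTop m),
        hN.eventually (hL.eventually_ge_atTop l)] with n h1 h2
      rw [if_pos]
      simp only [Finset.mem_product, Finset.mem_Icc]
      omega
  · refine Eventually.of_forall fun n p => ?_
    have hw := mul_nonneg (weight_nonneg p.1) (weight_nonneg p.2)
    split_ifs with hp
    · rw [Finset.mem_product, Finset.mem_Icc] at hp
      rw [Real.norm_of_nonneg (mul_nonneg hw (tsum_nonneg fun _ => abs_nonneg _))]
      exact mul_le_mul_of_nonneg_left (tsum_abs_freq_sub_freq_le _ _ _ _ _ p.2 hp.1.1) hw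
    · simpa using hw

end Typical

section Typical

variable {κ : ℕ} {θ : Fin (κ + 2) → ℝ} {Y : Fin (κ + 1) → ℕ → ℝ} {ρ : Fin (κ + 1) → Masses}

/-! ### The limit distance in terms of the position of the change points -/

theorem fin_eq_zero_or_last_or_interior (q : Fin (κ + 2)) :
    q = 0 ∨ q = Fin.last (κ + 1) ∨ ∃ k : Fin κ, q = k.castSucc.succ := by
  induction q using Fin.cases with
  | zero => exact Or.inl rfl
  | succ r =>
    induction r using Fin.lastCases with
    | last => exact Or.inr (Or.inl rfl)
    | cast k => exact Or.inr (Or.inr ⟨k, rfl⟩)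

/-- Some row occupies the sample immediately to the right of the relative position `u`. -/
theorem IsTypical.exists_row (H : IsTypical θ Y ρ) {u : ℝ} (hu : 0 ≤ u) (hu1 : u < 1) :
    ∃ r : Fin (κ + 1), θ r.castSucc ≤ u ∧ u < θ r.succ := by
  by_contra! h
  have : ∀ q : Fin (κ + 2), θ q ≤ u := by
    intro q
    induction q using Fin.induction with
    | zero => rw [H.zero]; exact hu
    | succ r ih => exact h r ih
  have := this (Fin.last _)
  rw [H.one] at this
  linarith

/-- A window without change points is covered by one row. -/
theorem IsTypical.exists_row_of_forall_notMem (H : IsTypical θ Y ρ) {u v : ℝ} (hu : 0 ≤ u)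
    (huv : u < v) (hv : v ≤ 1) (h : ∀ k : Fin κ, θ k.castSucc.succ ∉ Set.Ioo u v) :
    ∃ r : Fin (κ + 1), θ r.castSucc ≤ u ∧ v ≤ θ r.succ := by
  obtain ⟨r, hr, hr'⟩ := H.exists_row hu (huv.trans_le hv)
  refine ⟨r, hr, ?_⟩
  rcases fin_eq_zero_or_last_or_interior r.succ with h0 | h0 | ⟨k, hk⟩
  · exact absurd h0 (Fin.succ_ne_zero r)
  · rw [h0, H.one]; exact hv
  · by_contra! hlt
    exact h k (hk ▸ ⟨hr', hlt⟩)

/-- A window with a single change point is covered by the two rows adjacent to it. -/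
theorem IsTypical.le_of_unique (H : IsTypical θ Y ρ) {u v : ℝ} (hu : 0 ≤ u) (hv : v ≤ 1)
    {k : Fin κ} (hk : θ k.castSucc.succ ∈ Set.Ioo u v)
    (h : ∀ k' : Fin κ, θ k'.castSucc.succ ∈ Set.Ioo u v → k' = k) :
    θ k.castSucc.castSucc ≤ u ∧ v ≤ θ k.succ.succ := by
  have h1 : θ k.castSucc.castSucc < θ k.castSucc.succ := H.strictMono Fin.castSucc_lt_succ
  have h2 : θ k.castSucc.succ < θ k.succ.succ :=
    H.strictMono (Fin.succ_lt_succ_iff.2 Fin.castSucc_lt_succ)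
  constructor
  · rcases fin_eq_zero_or_last_or_interior k.castSucc.castSucc with h0 | h0 | ⟨k', hk'⟩
    · rw [h0, H.zero]; exact hu
    · rw [h0, H.one] at h1
      linarith [(H.mem_Icc k.castSucc.succ).2]
    · by_contra! hlt
      rw [hk'] at h1 hlt
      rw [h k' ⟨hlt, h1.trans hk.2⟩] at h1
      exact lt_irrefl _ h1
  · rcases fin_eq_zero_or_last_or_interior k.succ.succ with h0 | h0 | ⟨k', hk'⟩
    · exact absurd h0 (Fin.succ_ne_zero _)
    · rw [h0, H.one]; exact hv
    · by_contra! hlt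
      rw [hk'] at h2 hlt
      rw [h k' ⟨hk.1.trans h2, hlt⟩] at h2
      exact lt_irrefl _ h2

theorem cumulative_sub_cumulative (hθ : StrictMono θ) (r : Fin (κ + 1)) {a b : ℝ}
    (ha : a ∈ Set.Icc (θ r.castSucc) (θ r.succ)) (hb : b ∈ Set.Icc (θ r.castSucc) (θ r.succ))
    (m l : ℕ) (c : Fin m → ℤ) :
    cumulative θ ρ b m l c - cumulative θ ρ a m l c = (b - a) * ρ r m l c := by
  rw [cumulative, cumulative, ← Finset.sum_sub_distrib, Finset.sum_eq_single r]
  · rw [min_eq_left ha.2, min_eq_left hb.2, min_eq_right ha.1, min_eq_right hb.1]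
    ring
  · intro r' _ hr'
    have h0 := hθ (Fin.castSucc_lt_succ (i := r'))
    rcases lt_or_gt_of_ne hr' with hlt | hlt
    · have := hθ.monotone (Fin.succ_le_castSucc_iff.2 hlt)
      rw [min_eq_right (by linarith [hb.1]), min_eq_right (by linarith [hb.1]),
        min_eq_right (by linarith [ha.1]), min_eq_right (by linarith [ha.1])]
      ring
    · have := hθ.monotone (Fin.succ_le_castSucc_iff.2 hlt)
      rw [min_eq_left (by linarith [hb.2]), min_eq_left (by linarith [hb.2]),
        min_eq_left (by linarith [ha.2]), min_eq_left (by linarith [ha.2])]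
      ring
  · simp

theorem mixture_eq_row (hθ : StrictMono θ) (r : Fin (κ + 1)) {a b : ℝ}
    (ha : θ r.castSucc ≤ a) (hab : a < b) (hb : b ≤ θ r.succ) : mixture θ ρ a b = ρ r := by
  funext m l c
  rw [mixture, cumulative_sub_cumulative hθ r ⟨ha, hab.le.trans hb⟩ ⟨ha.trans hab.le, hb⟩,
    mul_div_cancel_left₀ _ (sub_pos.2 hab).ne']

/-- For a window `(u, v)` with its only change point at `s`, the distance between the limit laws of
the parts `(u, w)` and `(w, v)` is this factor times the distance between the laws of the two rows.
It is largest, namely `1`, at `w = s`. -/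
noncomputable def contrast (u v s w : ℝ) : ℝ :=
  if w ≤ s then (v - s) / (v - w) else (s - u) / (w - u)

theorem contrast_self {u v s : ℝ} (hv : s < v) : contrast u v s s = 1 := by
  rw [contrast, if_pos le_rfl, div_self (sub_pos.2 hv).ne']

theorem contrast_pos {u v s w : ℝ} (hs : s ∈ Set.Ioo u v) : 0 < contrast u v s w := by
  unfold contrast
  split_ifs with h
  · exact div_pos (by linarith [hs.2]) (by linarith [hs.2])
  · exact div_pos (by linarith [hs.1]) (by linarith [hs.1])

theorem eq_of_one_le_contrast {u v s w : ℝ} (hs : s ∈ Set.Ioo u v)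
    (h : 1 ≤ contrast u v s w) : w = s := by
  unfold contrast at h
  split_ifs at h with hw
  · rw [one_le_div (by linarith [hs.2])] at h
    linarith
  · rw [one_le_div (by linarith [hs.1])] at h
    linarith

theorem mixture_sub_mixture (hθ : StrictMono θ) {k : Fin κ} {u v w : ℝ} (hw : w ∈ Set.Ioo u v)
    (hk : θ k.castSucc.succ ∈ Set.Ioo u v) (hu : θ k.castSucc.castSucc ≤ u)
    (hv : v ≤ θ k.succ.succ) (m l : ℕ) (c : Fin m → ℤ) :
    mixture θ ρ u w m l c - mixture θ ρ w v m l c =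
      contrast u v (θ k.castSucc.succ) w * (ρ k.castSucc m l c - ρ k.succ m l c) := by
  have h1 := hw.1
  have h2 := hw.2
  have h3 := hk.1
  have h4 := hk.2
  rw [contrast]
  split_ifs with h
  · rw [mixture_eq_row hθ k.castSucc hu h1 h, mixture]
    have e1 := cumulative_sub_cumulative (ρ := ρ) hθ k.castSucc (a := w) (b := θ k.castSucc.succ)
      ⟨by linarith, h⟩ ⟨by linarith, le_rfl⟩ m l c
    have e2 := cumulative_sub_cumulative (ρ := ρ) hθ k.succ (a := θ k.castSucc.succ) (b := v)
      ⟨le_rfl, by linarith⟩ ⟨h4.le, hv⟩ m l c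
    rw [show cumulative θ ρ v m l c - cumulative θ ρ w m l c =
      (v - θ k.castSucc.succ) * ρ k.succ m l c + (θ k.castSucc.succ - w) * ρ k.castSucc m l c by
        linarith]
    have : v - w ≠ 0 := by linarith
    field_simp
    ring
  · rw [not_le] at h
    rw [mixture_eq_row hθ k.succ (a := w) h.le h2 hv, mixture]
    have e1 := cumulative_sub_cumulative (ρ := ρ) hθ k.castSucc (a := u) (b := θ k.castSucc.succ)
      ⟨hu, h3.le⟩ ⟨by linarith, le_rfl⟩ m l c
    have e2 := cumulative_sub_cumulative (ρ := ρ) hθ k.succ (a := θ k.castSucc.succ) (b := w)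
      ⟨le_rfl, by linarith⟩ ⟨h.le, h2.le.trans hv⟩ m l c
    rw [show cumulative θ ρ w m l c - cumulative θ ρ u m l c =
      (w - θ k.castSucc.succ) * ρ k.succ m l c + (θ k.castSucc.succ - u) * ρ k.castSucc m l c by
        linarith]
    have : w - u ≠ 0 := by linarith
    field_simp
    ring

theorem massDist_self (q : Masses) : massDist q q = 0 := by simp [massDist]

theorem massDist_eq_mul {q q' p p' : Masses} {t : ℝ} (ht : 0 ≤ t)
    (h : ∀ m l c, q m l c - q' m l c = t * (p m l c - p' m l c)) :
    massDist q q' = t * massDist p p' := by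
  rw [massDist, massDist, ← tsum_mul_left]
  refine tsum_congr fun i => ?_
  simp_rw [h, abs_mul, abs_of_nonneg ht, tsum_mul_left]
  ring

theorem massDist_mixture (hθ : StrictMono θ) {k : Fin κ} {u v w : ℝ} (hw : w ∈ Set.Ioo u v)
    (hk : θ k.castSucc.succ ∈ Set.Ioo u v) (hu : θ k.castSucc.castSucc ≤ u)
    (hv : v ≤ θ k.succ.succ) :
    massDist (mixture θ ρ u w) (mixture θ ρ w v) =
      contrast u v (θ k.castSucc.succ) w * massDist (ρ k.castSucc) (ρ k.succ) :=
  massDist_eq_mul (contrast_pos hk).le (mixture_sub_mixture hθ hw hk hu hv)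

theorem IsTypical.massDist_pos (H : IsTypical θ Y ρ) (k : Fin κ) :
    0 < massDist (ρ k.castSucc) (ρ k.succ) := by
  obtain ⟨m, l, hm, hl, hne⟩ := H.ne k
  obtain ⟨c, hc⟩ := Function.ne_iff.1 hne
  have hs : ∀ m l, Summable fun c => |ρ k.castSucc m l c - ρ k.succ m l c| := fun m l =>
    ((H.hasSum k.castSucc m l).summable.sub (H.hasSum k.succ m l).summable).abs
  have hw : ∀ j, 1 ≤ j → 0 < weight j := fun j hj => by unfold weight; positivity
  have h0 : ∀ p : ℕ × ℕ, 0 ≤ weight p.1 * weight p.2 *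
      ∑' c : Fin p.1 → ℤ, |ρ k.castSucc p.1 p.2 c - ρ k.succ p.1 p.2 c| := fun p =>
    mul_nonneg (mul_nonneg (weight_nonneg _) (weight_nonneg _)) (tsum_nonneg fun _ => abs_nonneg _)
  refine Summable.tsum_pos ?_ h0 (m, l) ?_
  · refine (hasSum_weight_mul_weight.mul_right 2).summable.of_nonneg_of_le h0 fun p => ?_
    refine mul_le_mul_of_nonneg_left ?_ (mul_nonneg (weight_nonneg _) (weight_nonneg _))
    have h := (H.hasSum k.castSucc p.1 p.2).add (H.hasSum k.succ p.1 p.2)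
    rw [one_add_one_eq_two] at h
    rw [← h.tsum_eq]
    refine (hs _ _).tsum_le_tsum (fun c => ?_) h.summable
    have h1 := H.nonneg k.castSucc p.1 p.2 c
    have h2 := H.nonneg k.succ p.1 p.2 c
    rw [abs_le]
    constructor <;> linarith
  · refine mul_pos (mul_pos (hw m hm) (hw l hl)) ?_
    exact (hs m l).tsum_pos (fun _ => abs_nonneg _) c (abs_pos.2 (sub_ne_zero.2 hc))

/-! ### Limits of the scores and of the single-change-point estimates -/

/-- The limit of the score of the part of the sample between the relative positions `u`, `v`. -/
noncomputable def scoreLimit (θ : Fin (κ + 2) → ℝ) (ρ : Fin (κ + 1) → Masses) (u v : ℝ) : ℝ :=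
  massDist (mixture θ ρ u ((u + v) / 2)) (mixture θ ρ ((u + v) / 2) v)

theorem tendsto_nat_half_div {F : Filter ℕ} (hF : F ≤ atTop) {a : ℕ → ℕ} {u : ℝ}
    (ha : Tendsto (fun n => (a n : ℝ) / n) F (𝓝 u)) :
    Tendsto (fun n => ((a n / 2 : ℕ) : ℝ) / n) F (𝓝 (u / 2)) := by
  have hinv : Tendsto (fun n : ℕ => 1 / (n : ℝ)) F (𝓝 0) :=
    tendsto_one_div_atTop_nhds_zero_nat.mono_left hF
  have h1 := (ha.div_const 2).sub hinv
  rw [sub_zero] at h1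
  refine tendsto_of_tendsto_of_tendsto_of_le_of_le h1 (ha.div_const 2) (fun n => ?_) fun n => ?_
  · have h : a n ≤ 2 * (a n / 2) + 2 := by omega
    have h : (a n : ℝ) ≤ 2 * ((a n / 2 : ℕ) : ℝ) + 2 := by exact_mod_cast h
    change (a n : ℝ) / n / 2 - 1 / n ≤ _
    rw [div_right_comm, ← sub_div]
    gcongr
    linarith
  · change _ ≤ (a n : ℝ) / n / 2
    rw [div_right_comm]
    gcongr
    exact Nat.cast_div_le

theorem IsTypical.tendsto_delta (H : IsTypical θ Y ρ) {M L : ℕ → ℕ} (hM : Tendsto M atTop atTop)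
    (hL : Tendsto L atTop atTop) {F : Filter ℕ} (hF : F ≤ atTop)
    {a b : ℕ → ℕ} {u v : ℝ} (huv : u < v) (hv : v ≤ 1)
    (ha : Tendsto (fun n => (a n : ℝ) / n) F (𝓝 u))
    (hb : Tendsto (fun n => (b n : ℝ) / n) F (𝓝 v)) :
    Tendsto (fun n => delta M L (sample θ n Y) (a n) (b n)) F (𝓝 (scoreLimit θ ρ u v)) := by
  have hinv : Tendsto (fun n : ℕ => 1 / (n : ℝ)) F (𝓝 0) :=
    tendsto_one_div_atTop_nhds_zero_nat.mono_left hF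
  have h1 : Tendsto (fun n => ((a n + b n : ℕ) : ℝ) / n) F (𝓝 (u + v)) :=
    (ha.add hb).congr fun n => by push_cast; ring
  have h2 : Tendsto (fun n => ((a n + b n + 1 : ℕ) : ℝ) / n) F (𝓝 (u + v)) := by
    have h := h1.add hinv
    rw [add_zero] at h
    exact h.congr fun n => by push_cast; ring
  exact H.tendsto_dHat hM hL hF (by linarith) (by linarith) (by linarith) hv ha
    (tendsto_nat_half_div hF h1) (tendsto_nat_half_div hF h2) hb

theorem IsTypical.scoreLimit_eq_zero (H : IsTypical θ Y ρ) {u v : ℝ} (hu : 0 ≤ u)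
    (huv : u < v) (hv : v ≤ 1) (h : ∀ k : Fin κ, θ k.castSucc.succ ∉ Set.Ioo u v) :
    scoreLimit θ ρ u v = 0 := by
  obtain ⟨r, h1, h2⟩ := H.exists_row_of_forall_notMem hu huv hv h
  rw [scoreLimit, mixture_eq_row H.strictMono r h1 (by linarith) (by linarith),
    mixture_eq_row H.strictMono r (by linarith) (by linarith) h2, massDist_self]

theorem IsTypical.scoreLimit_pos (H : IsTypical θ Y ρ) {u v : ℝ} (hu : 0 ≤ u) (hv : v ≤ 1)
    {k : Fin κ} (hk : θ k.castSucc.succ ∈ Set.Ioo u v)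
    (h : ∀ k' : Fin κ, θ k'.castSucc.succ ∈ Set.Ioo u v → k' = k) :
    0 < scoreLimit θ ρ u v := by
  obtain ⟨h1, h2⟩ := H.le_of_unique hu hv hk h
  have := hk.1.trans hk.2
  rw [scoreLimit, massDist_mixture H.strictMono ⟨by linarith, by linarith⟩ hk h1 h2]
  exact mul_pos (contrast_pos hk) (H.massDist_pos k)

/-- The single-change-point estimator is consistent in a window with a single change point: along
an ultrafilter its relative position converges, and the limit objective has its only maximum at
the change point. -/
theorem IsTypical.tendsto_of_isPhi (H : IsTypical θ Y ρ) {M L : ℕ → ℕ}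
    (hM : Tendsto M atTop atTop) (hL : Tendsto L atTop atTop)
    {a b p : ℕ → ℕ} {u v α : ℝ} (hα : 0 < α) (hu : 0 ≤ u - α) (hv : v + α ≤ 1)
    (ha : Tendsto (fun n => (a n : ℝ) / n) atTop (𝓝 u))
    (hb : Tendsto (fun n => (b n : ℝ) / n) atTop (𝓝 v))
    {k : Fin κ} (hk : θ k.castSucc.succ ∈ Set.Ioo u v)
    (h : ∀ k' : Fin κ, θ k'.castSucc.succ ∈ Set.Ioo (u - α) (v + α) → k' = k)
    (hp : ∀ᶠ n in atTop, IsPhi M L n (sample θ n Y) α (a n) (b n) (p n)) :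
    Tendsto (fun n => (p n : ℝ) / n) atTop (𝓝 (θ k.castSucc.succ)) := by
  have hk' : θ k.castSucc.succ ∈ Set.Ioo (u - α) (v + α) :=
    ⟨by linarith [hk.1], by linarith [hk.2]⟩
  obtain ⟨hl, hr⟩ := H.le_of_unique hu hv hk' h
  have hinv := tendsto_one_div_atTop_nhds_zero_nat (𝕜 := ℝ)
  have hfl := tendsto_nat_floor_mul_div hα.le le_rfl
  have hA : Tendsto (fun n : ℕ => ((max 1 (a n - ⌊(n : ℝ) * α⌋₊) : ℕ) : ℝ) / n) atTop
      (𝓝 (u - α)) := by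
    have h1 := hinv.max ((ha.sub hfl).max (tendsto_const_nhds (x := (0 : ℝ))))
    rw [max_eq_left hu, max_eq_right hu] at h1
    refine h1.congr fun n => ?_
    rw [← sub_div, Nat.cast_max, Nat.cast_one, ← max_div_div_right (Nat.cast_nonneg n)]
    congr 1
    rcases le_total ⌊(n : ℝ) * α⌋₊ (a n) with hle | hle
    · rw [Nat.cast_sub hle, max_eq_left]
      exact div_nonneg (sub_nonneg.2 (by exact_mod_cast hle)) (Nat.cast_nonneg n)
    · rw [Nat.sub_eq_zero_of_le hle, Nat.cast_zero, zero_div, max_eq_right]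
      exact div_nonpos_of_nonpos_of_nonneg (sub_nonpos.2 (by exact_mod_cast hle))
        (Nat.cast_nonneg n)
  have hB : Tendsto (fun n : ℕ => ((min n (b n + ⌊(n : ℝ) * α⌋₊) : ℕ) : ℝ) / n) atTop
      (𝓝 (v + α)) := by
    have h1 := (tendsto_const_nhds (x := (1 : ℝ))).min (hb.add hfl)
    rw [min_eq_right hv] at h1
    refine h1.congr' ?_
    filter_upwards [eventually_gt_atTop 0] with n hn
    rw [← add_div, Nat.cast_min, ← min_div_div_right (Nat.cast_nonneg n),
      div_self (by exact_mod_cast hn.ne'), Nat.cast_add]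
  have hobj : ∀ {F : Filter ℕ} (_ : F ≤ atTop) {t : ℕ → ℕ} {x : ℝ} (_ : x ∈ Set.Icc u v)
      (_ : Tendsto (fun n => (t n : ℝ) / n) F (𝓝 x)),
      Tendsto (fun n => phiObjective M L n (sample θ n Y) α (a n) (b n) (t n)) F
        (𝓝 (contrast (u - α) (v + α) (θ k.castSucc.succ) x *
          massDist (ρ k.castSucc) (ρ k.succ))) := by
    intro F hF t x hx ht
    rw [← massDist_mixture H.strictMono ⟨by linarith [hx.1], by linarith [hx.2]⟩ hk' hl hr]
    exact H.tendsto_dHat hM hL hF (by linarith [hx.1]) (by linarith [hx.2]) (by linarith [hx.2]) hv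
      (hA.mono_left hF) ht ht (hB.mono_left hF)
  rw [tendsto_iff_ultrafilter]
  intro G hG
  have hbd : ∀ᶠ n in (G : Filter ℕ), (a n : ℝ) / n ≤ p n / n ∧ (p n : ℝ) / n ≤ b n / n := by
    filter_upwards [hG hp] with n hn
    have h1 := Finset.mem_Icc.1 hn.1
    constructor
    · have : (a n : ℝ) ≤ p n := by exact_mod_cast h1.1
      gcongr
    · have : (p n : ℝ) ≤ b n := by exact_mod_cast h1.2
      gcongr
  obtain ⟨x, -, hx⟩ := (isCompact_Icc (a := (0 : ℝ)) (b := 2)).ultrafilter_le_nhds'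
    (G.map fun n => (p n : ℝ) / n) (by
      rw [Ultrafilter.mem_map]
      change ∀ᶠ n in (G : Filter ℕ), (p n : ℝ) / n ∈ Set.Icc (0 : ℝ) 2
      filter_upwards [hbd, (hb.mono_left hG).eventually_le_const (by linarith : v < 2)] with n h1 h2
      exact ⟨by positivity, h1.2.trans h2⟩)
  have hx : Tendsto (fun n => (p n : ℝ) / n) G (𝓝 x) := hx
  have hxm : x ∈ Set.Icc u v :=
    ⟨le_of_tendsto_of_tendsto (ha.mono_left hG) hx (hbd.mono fun _ h => h.1),
      le_of_tendsto_of_tendsto hx (hb.mono_left hG) (hbd.mono fun _ h => h.2)⟩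
  have hfl' := tendsto_nat_floor_mul_div (H.mem_Icc k.castSucc.succ).1 hG
  have hle := le_of_tendsto_of_tendsto (hobj hG ⟨hk.1.le, hk.2.le⟩ hfl') (hobj hG hxm hx) (by
    -- the change point itself competes in the maximization, rounded to a position of the sample
    filter_upwards [hG hp, eventually_add_le hG hk.1 (ha.mono_left hG) hfl' 0,
      eventually_add_le hG hk.2 hfl' (hb.mono_left hG) 0] with n h1 h2 h3
    exact h1.2 _ (Finset.mem_Icc.2 ⟨h2, h3⟩))
  rw [contrast_self hk'.2] at hle
  rwa [← eq_of_one_le_contrast hk' (le_of_mul_le_mul_right hle (H.massDist_pos k))]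

end Typical

/-! ### The grids -/

theorem step_pos (j : ℕ) : 0 < step j := by unfold step; positivity

/-- The relative position `α_j (i + 1/(t+1))` of the `i`-th boundary of the grid `(t, j)`. -/
noncomputable def gridPoint (t j i : ℕ) : ℝ := step j * ((i : ℝ) + 1 / ((t : ℝ) + 1))

theorem gridPoint_strictMono (t j : ℕ) : StrictMono (gridPoint t j) := fun a b hab => by
  have : (a : ℝ) < b := by exact_mod_cast hab
  exact mul_lt_mul_of_pos_left (by linarith) (step_pos j)

theorem gridPoint_pos (t j i : ℕ) : 0 < gridPoint t j i :=
  mul_pos (step_pos j) (by positivity)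

theorem gridPoint_add (t j i d : ℕ) : gridPoint t j (i + d) = gridPoint t j i + d * step j := by
  unfold gridPoint
  push_cast
  ring

theorem le_gridSize_iff {t j i : ℕ} (hi : 0 < i) :
    i ≤ gridSize t j ↔ gridPoint t j i ≤ 1 := by
  rw [gridSize, Nat.le_floor_iff' hi.ne', gridPoint, ← le_div_iff₀' (step_pos j), le_sub_iff_add_le]

theorem gridPoint_le_one {t j i : ℕ} (hi : i ≤ gridSize t j) : gridPoint t j i ≤ 1 := by
  rcases i.eq_zero_or_pos with rfl | h
  · have h1 : step j ≤ 1 := by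
      unfold step
      have := pow_le_one₀ (n := j) (by norm_num : (0 : ℝ) ≤ 1 / 2) (by norm_num)
      linarith
    have h2 : 1 / ((t : ℝ) + 1) ≤ 1 := by
      rw [div_le_one (by positivity)]
      linarith [Nat.cast_nonneg (α := ℝ) t]
    rw [gridPoint, Nat.cast_zero, zero_add]
    exact mul_le_one₀ h1 (by positivity) h2
  · exact (le_gridSize_iff h).1 hi

theorem tendsto_boundary_div (t j i : ℕ) :
    Tendsto (fun n => (boundary n t j i : ℝ) / n) atTop (𝓝 (gridPoint t j i)) := by
  have h := (tendsto_one_div_atTop_nhds_zero_nat (𝕜 := ℝ)).max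
    (tendsto_nat_floor_mul_div (gridPoint_pos t j i).le le_rfl)
  rw [max_eq_right (gridPoint_pos t j i).le] at h
  refine h.congr fun n => ?_
  rw [max_div_div_right (Nat.cast_nonneg n), boundary, gridPoint, ← mul_assoc]
  push_cast
  rfl

theorem boundary_le {n t j i : ℕ} (hn : 1 ≤ n) (hi : i ≤ gridSize t j) : boundary n t j i ≤ n := by
  refine max_le hn (Nat.floor_le_of_le ?_)
  rw [mul_assoc]
  exact mul_le_of_le_one_right (Nat.cast_nonneg n) (gridPoint_le_one hi)

/-! ### The performance score of a grid -/

theorem kthHighest_nonneg (κ N : ℕ) {d : ℕ → ℝ} (hd : ∀ i, 0 ≤ d i) : 0 ≤ kthHighest κ N d := by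
  unfold kthHighest
  by_cases h : κ ≤ N
  · refine Real.sSup_nonneg' ⟨0, ?_, le_rfl⟩
    simpa [hd] using h
  · rw [Set.eq_empty_of_forall_notMem (s := {u : ℝ | _}), Real.sSup_empty]
    intro u hu
    have h1 := (Finset.card_filter_le (Finset.Icc 1 N) fun i => u ≤ d i)
    rw [Nat.card_Icc] at h1
    exact h ((le_trans hu h1).trans (by omega))

theorem exists_mem_Icc_le {κ N : ℕ} {d : ℕ → ℝ} {u : ℝ} (hκ : 0 < κ)
    (hu : κ ≤ ((Finset.Icc 1 N).filter fun i => u ≤ d i).card) : ∃ i ∈ Finset.Icc 1 N, u ≤ d i := by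
  obtain ⟨i, hi⟩ := Finset.card_pos.1 (hκ.trans_le hu)
  exact ⟨i, Finset.mem_filter.1 hi⟩

theorem kthHighest_le {κ N : ℕ} {d : ℕ → ℝ} {C : ℝ} (hκ : 0 < κ) (hC : 0 ≤ C) (hd : ∀ i, d i ≤ C) :
    kthHighest κ N d ≤ C :=
  Real.sSup_le (fun _ hu => let ⟨i, _, hi⟩ := exists_mem_Icc_le hκ hu; hi.trans (hd i)) hC

theorem kthHighest_eq_zero {κ N : ℕ} {d : ℕ → ℝ} (h : N < κ) : kthHighest κ N d = 0 := by
  rw [kthHighest, Set.eq_empty_of_forall_notMem (s := {u : ℝ | _}), Real.sSup_empty]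
  intro u hu
  have h1 := (Finset.card_filter_le (Finset.Icc 1 N) fun i => u ≤ d i)
  rw [Nat.card_Icc] at h1
  have := le_trans hu h1
  omega

theorem le_kthHighest {κ N : ℕ} {d : ℕ → ℝ} {C c : ℝ} (hκ : 0 < κ) (hd : ∀ i, d i ≤ C)
    (hc : κ ≤ ((Finset.Icc 1 N).filter fun i => c ≤ d i).card) : c ≤ kthHighest κ N d :=
  le_csSup ⟨C, fun _ hu => let ⟨i, _, hi⟩ := exists_mem_Icc_le hκ hu; hi.trans (hd i)⟩ hc

/-- If fewer than `κ` of the values have an index in `S`, the `κ`-th highest value is at most the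
sum of the values with an index outside `S`. -/
theorem kthHighest_le_sum {κ N : ℕ} {d : ℕ → ℝ} (hd : ∀ i, 0 ≤ d i) {S : Finset ℕ}
    (hS : S.card < κ) : kthHighest κ N d ≤ ∑ i ∈ Finset.Icc 1 N \ S, d i := by
  refine Real.sSup_le (fun u hu => ?_) (Finset.sum_nonneg fun i _ => hd i)
  obtain ⟨i, hi, hiS⟩ := Finset.exists_mem_notMem_of_card_lt_card (hS.trans_le hu)
  obtain ⟨hi1, hi2⟩ := Finset.mem_filter.1 hi
  exact hi2.trans (Finset.single_le_sum (fun i _ => hd i) (Finset.mem_sdiff.2 ⟨hi1, hiS⟩))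

theorem gammaPart_mem_Icc (M L : ℕ → ℕ) {κ : ℕ} (hκ : 0 < κ) (n : ℕ) (x : ℕ → ℝ) (t j l : ℕ) :
    gammaPart M L κ n x t j l ∈ Set.Icc (0 : ℝ) 2 :=
  ⟨kthHighest_nonneg _ _ fun _ => dHat_nonneg _ _ _ _ _ _ _,
    kthHighest_le hκ zero_le_two fun _ => dHat_le _ _ _ _ _ _ _⟩

theorem gamma_mem_Icc (M L : ℕ → ℕ) {κ : ℕ} (hκ : 0 < κ) (n : ℕ) (x : ℕ → ℝ) (t j : ℕ) :
    gamma M L κ n x t j ∈ Set.Icc (0 : ℝ) 2 :=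
  ⟨le_min (le_min (gammaPart_mem_Icc M L hκ n x t j 0).1 (gammaPart_mem_Icc M L hκ n x t j 1).1)
      (gammaPart_mem_Icc M L hκ n x t j 2).1,
    (min_le_right _ _).trans (gammaPart_mem_Icc M L hκ n x t j 2).2⟩

theorem gamma_le_gammaPart (M L : ℕ → ℕ) (κ n : ℕ) (x : ℕ → ℝ) (t j : ℕ) {l : ℕ} (hl : l < 3) :
    gamma M L κ n x t j ≤ gammaPart M L κ n x t j l := by
  unfold gamma
  interval_cases l
  · exact (min_le_left _ _).trans (min_le_left _ _)
  · exact (min_le_left _ _).trans (min_le_right _ _)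
  · exact min_le_right _ _

theorem gamma_eq_zero {M L : ℕ → ℕ} {κ n : ℕ} {x : ℕ → ℝ} {t j : ℕ} (h : gridSize t j < κ) :
    gamma M L κ n x t j = 0 := by
  unfold gamma gammaPart
  rw [kthHighest_eq_zero (by omega), kthHighest_eq_zero (by omega), kthHighest_eq_zero (by omega)]
  simp

section Typical

variable {κ : ℕ} {θ : Fin (κ + 2) → ℝ} {Y : Fin (κ + 1) → ℕ → ℝ} {ρ : Fin (κ + 1) → Masses}
  {M L : ℕ → ℕ}

/-- The limit of the score of the `i`-th of the segments of three steps that start at `b_l`. -/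
noncomputable def tripleLimit (θ : Fin (κ + 2) → ℝ) (ρ : Fin (κ + 1) → Masses) (t j l i : ℕ) : ℝ :=
  scoreLimit θ ρ (gridPoint t j (l + 3 * (i - 1))) (gridPoint t j (l + 3 * i))

open Classical in
/-- The segments of three steps, starting at `b_l`, whose score does not vanish in the limit. -/
noncomputable def activeTriples (θ : Fin (κ + 2) → ℝ) (ρ : Fin (κ + 1) → Masses) (t j l : ℕ) :
    Finset ℕ :=
  (Finset.Icc 1 ((gridSize t j - l) / 3)).filter fun i => tripleLimit θ ρ t j l i ≠ 0

/-- A grid is separating if its performance score does not vanish in the limit: for each of the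
three offsets at least `κ` segments of three steps have a nonzero limit score. -/
def IsSeparating (θ : Fin (κ + 2) → ℝ) (ρ : Fin (κ + 1) → Masses) (t j : ℕ) : Prop :=
  ∀ l < 3, κ ≤ (activeTriples θ ρ t j l).card

theorem mem_activeTriples {t j l i : ℕ} : i ∈ activeTriples θ ρ t j l ↔
    1 ≤ i ∧ i ≤ (gridSize t j - l) / 3 ∧ tripleLimit θ ρ t j l i ≠ 0 := by
  simp [activeTriples, and_assoc]

theorem IsTypical.tendsto_segment_score (H : IsTypical θ Y ρ) (hM : Tendsto M atTop atTop)
    (hL : Tendsto L atTop atTop) {t j i i' : ℕ} (hi : i < i') (hi' : i' ≤ gridSize t j) :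
    Tendsto (fun n => delta M L (sample θ n Y) (boundary n t j i) (boundary n t j i')) atTop
      (𝓝 (scoreLimit θ ρ (gridPoint t j i) (gridPoint t j i'))) :=
  H.tendsto_delta hM hL le_rfl (gridPoint_strictMono t j hi) (gridPoint_le_one hi')
    (tendsto_boundary_div t j i) (tendsto_boundary_div t j i')

theorem IsTypical.tendsto_gamma_of_not_isSeparating (H : IsTypical θ Y ρ)
    (hM : Tendsto M atTop atTop) (hL : Tendsto L atTop atTop) (hκ : 0 < κ) {t j : ℕ}
    (h : ¬ IsSeparating θ ρ t j) :
    Tendsto (fun n => gamma M L κ n (sample θ n Y) t j) atTop (𝓝 0) := by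
  unfold IsSeparating at h
  push Not at h
  obtain ⟨l, hl, hcard⟩ := h
  have h0 : Tendsto (fun n => ∑ i ∈ Finset.Icc 1 ((gridSize t j - l) / 3) \ activeTriples θ ρ t j l,
      delta M L (sample θ n Y) (boundary n t j (l + 3 * (i - 1))) (boundary n t j (l + 3 * i)))
      atTop (𝓝 (∑ i ∈ Finset.Icc 1 ((gridSize t j - l) / 3) \ activeTriples θ ρ t j l, 0)) := by
    refine tendsto_finsetSum _ fun i hi => ?_
    rw [Finset.mem_sdiff, Finset.mem_Icc, mem_activeTriples] at hi
    have : tripleLimit θ ρ t j l i = 0 := by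
      by_contra hne
      exact hi.2 ⟨hi.1.1, hi.1.2, hne⟩
    rw [← this]
    exact H.tendsto_segment_score hM hL (by omega) (by omega)
  rw [Finset.sum_const_zero] at h0
  refine squeeze_zero (fun n => (gamma_mem_Icc M L hκ n _ t j).1) (fun n => ?_) h0
  exact (gamma_le_gammaPart M L κ n _ t j hl).trans
    (kthHighest_le_sum (fun _ => dHat_nonneg _ _ _ _ _ _ _) hcard)

theorem massDist_nonneg (q q' : Masses) : 0 ≤ massDist q q' :=
  tsum_nonneg fun _ => mul_nonneg (mul_nonneg (weight_nonneg _) (weight_nonneg _))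
    (tsum_nonneg fun _ => abs_nonneg _)

theorem IsTypical.eventually_le_gammaPart (H : IsTypical θ Y ρ)
    (hM : Tendsto M atTop atTop) (hL : Tendsto L atTop atTop) (hκ : 0 < κ) {t j l : ℕ}
    (h : κ ≤ (activeTriples θ ρ t j l).card) :
    ∃ c > 0, ∀ᶠ n in atTop, c ≤ gammaPart M L κ n (sample θ n Y) t j l := by
  have hc : ∀ᶠ c in 𝓝[>] (0 : ℝ), ∀ i ∈ activeTriples θ ρ t j l, c < tripleLimit θ ρ t j l i := by
    rw [eventually_all_finset]
    intro i hi
    have : 0 < tripleLimit θ ρ t j l i :=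
      lt_of_le_of_ne (massDist_nonneg _ _) (mem_activeTriples.1 hi).2.2.symm
    exact nhdsWithin_le_nhds (eventually_lt_nhds this)
  obtain ⟨c, hc, hc0⟩ := (hc.and self_mem_nhdsWithin).exists
  refine ⟨c, hc0, ?_⟩
  have hev : ∀ᶠ n in atTop, ∀ i ∈ activeTriples θ ρ t j l, c < delta M L (sample θ n Y)
      (boundary n t j (l + 3 * (i - 1))) (boundary n t j (l + 3 * i)) := by
    rw [eventually_all_finset]
    intro i hi
    have h1 := mem_activeTriples.1 hi
    exact (H.tendsto_segment_score hM hL (by omega) (by omega)).eventually_const_lt (hc i hi)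
  filter_upwards [hev] with n hn
  refine le_kthHighest hκ (C := 2) (fun _ => dHat_le _ _ _ _ _ _ _) (h.trans ?_)
  refine Finset.card_le_card fun i hi => Finset.mem_filter.2 ⟨?_, (hn i hi).le⟩
  have h1 := mem_activeTriples.1 hi
  exact Finset.mem_Icc.2 ⟨h1.1, h1.2.1⟩

theorem IsTypical.eventually_le_gamma (H : IsTypical θ Y ρ)
    (hM : Tendsto M atTop atTop) (hL : Tendsto L atTop atTop) (hκ : 0 < κ) {t j : ℕ}
    (h : IsSeparating θ ρ t j) :
    ∃ c > 0, ∀ᶠ n in atTop, c ≤ gamma M L κ n (sample θ n Y) t j := by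
  obtain ⟨c₀, hc₀, h₀⟩ := H.eventually_le_gammaPart hM hL hκ (h 0 (by norm_num))
  obtain ⟨c₁, hc₁, h₁⟩ := H.eventually_le_gammaPart hM hL hκ (h 1 (by norm_num))
  obtain ⟨c₂, hc₂, h₂⟩ := H.eventually_le_gammaPart hM hL hκ (h 2 (by norm_num))
  refine ⟨min (min c₀ c₁) c₂, lt_min (lt_min hc₀ hc₁) hc₂, ?_⟩
  filter_upwards [h₀, h₁, h₂] with n a b c
  exact min_le_min (min_le_min a b) c

/-! ### The change points in a separating grid -/

theorem triple_index_unique {t j l i i' : ℕ} {y : ℝ} (hi : 1 ≤ i) (hi' : 1 ≤ i')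
    (h : y ∈ Set.Ioo (gridPoint t j (l + 3 * (i - 1))) (gridPoint t j (l + 3 * i)))
    (h' : y ∈ Set.Ioo (gridPoint t j (l + 3 * (i' - 1))) (gridPoint t j (l + 3 * i'))) :
    i = i' := by
  have h1 := (gridPoint_strictMono t j).lt_iff_lt.1 (h.1.trans h'.2)
  have h2 := (gridPoint_strictMono t j).lt_iff_lt.1 (h'.1.trans h.2)
  omega

/-- In a separating grid, for each offset, the `κ` or more active segments of three steps contain
pairwise different change points, so every change point is in exactly one of them, and alone. -/
theorem IsTypical.active_bijection (H : IsTypical θ Y ρ) {t j l : ℕ}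
    (h : κ ≤ (activeTriples θ ρ t j l).card) (k : Fin κ) :
    (∃ i, 1 ≤ i ∧ l + 3 * i ≤ gridSize t j ∧ θ k.castSucc.succ ∈
      Set.Ioo (gridPoint t j (l + 3 * (i - 1))) (gridPoint t j (l + 3 * i))) ∧
    ∀ i k', 1 ≤ i → θ k.castSucc.succ ∈
        Set.Ioo (gridPoint t j (l + 3 * (i - 1))) (gridPoint t j (l + 3 * i)) →
      θ k'.castSucc.succ ∈
        Set.Ioo (gridPoint t j (l + 3 * (i - 1))) (gridPoint t j (l + 3 * i)) → k = k' := by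
  have : Nonempty (Fin κ) := ⟨k⟩
  have hex : ∀ i ∈ activeTriples θ ρ t j l, ∃ k : Fin κ, θ k.castSucc.succ ∈
      Set.Ioo (gridPoint t j (l + 3 * (i - 1))) (gridPoint t j (l + 3 * i)) := by
    intro i hi
    have h1 := mem_activeTriples.1 hi
    by_contra! hno
    exact h1.2.2 (H.scoreLimit_eq_zero (gridPoint_pos t j _).le
      (gridPoint_strictMono t j (by omega)) (gridPoint_le_one (by omega)) hno)
  choose! f hf using hex
  have hinj : Set.InjOn f (activeTriples θ ρ t j l) := fun i hi i' hi' heq =>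
    triple_index_unique (mem_activeTriples.1 hi).1 (mem_activeTriples.1 hi').1 (hf i hi)
      (heq ▸ hf i' hi')
  have huniv : (activeTriples θ ρ t j l).image f = Finset.univ := by
    rw [← Finset.card_eq_iff_eq_univ, Finset.card_image_of_injOn hinj, Fintype.card_fin]
    refine le_antisymm ?_ h
    rw [← Finset.card_image_of_injOn hinj]
    exact (Finset.card_le_univ _).trans_eq (Fintype.card_fin κ)
  have hsurj : ∀ k, ∃ i ∈ activeTriples θ ρ t j l, f i = k := fun k => by
    rw [← Finset.mem_image, huniv]
    exact Finset.mem_univ k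
  constructor
  · obtain ⟨i, hi, rfl⟩ := hsurj k
    have h1 := mem_activeTriples.1 hi
    exact ⟨i, h1.1, by omega, hf i hi⟩
  · intro i k' hi hk hk'
    obtain ⟨i₁, hi₁, rfl⟩ := hsurj k
    obtain ⟨i₂, hi₂, rfl⟩ := hsurj k'
    rw [triple_index_unique (mem_activeTriples.1 hi₁).1 hi (hf i₁ hi₁) hk,
      triple_index_unique (mem_activeTriples.1 hi₂).1 hi (hf i₂ hi₂) hk']

/-- Any three consecutive cells of a separating grid contain at most one change point. -/
theorem IsTypical.eq_of_mem_triple (H : IsTypical θ Y ρ) {t j : ℕ} (h : IsSeparating θ ρ t j)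
    {e : ℕ} {k k' : Fin κ}
    (hk : θ k.castSucc.succ ∈ Set.Ioo (gridPoint t j e) (gridPoint t j (e + 3)))
    (hk' : θ k'.castSucc.succ ∈ Set.Ioo (gridPoint t j e) (gridPoint t j (e + 3))) : k = k' := by
  refine (H.active_bijection (h (e % 3) (by omega)) k).2 (e / 3 + 1) k' (by omega) ?_ ?_ <;>
  rwa [show e % 3 + 3 * (e / 3 + 1 - 1) = e by omega,
    show e % 3 + 3 * (e / 3 + 1) = e + 3 by omega]

/-- In a separating grid every change point is in the interior of a cell which is at least two
cells away from the first and from the last one. -/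
theorem IsTypical.exists_cell (H : IsTypical θ Y ρ) {t j : ℕ} (h : IsSeparating θ ρ t j)
    (k : Fin κ) : ∃ c, 2 ≤ c ∧ c + 3 ≤ gridSize t j ∧
      θ k.castSucc.succ ∈ Set.Ioo (gridPoint t j c) (gridPoint t j (c + 1)) := by
  have hmono := gridPoint_strictMono t j
  have hA := fun l (hl : l < 3) => (H.active_bijection (h l hl) k).1
  have hex : ∃ c, θ k.castSucc.succ ≤ gridPoint t j (c + 1) := by
    obtain ⟨i, hi, -, h1⟩ := hA 0 (by norm_num)
    exact ⟨0 + 3 * i, h1.2.le.trans (hmono.monotone (Nat.le_succ _))⟩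
  classical
  set c := Nat.find hex with hc
  have hc1 : θ k.castSucc.succ ≤ gridPoint t j (c + 1) := Nat.find_spec hex
  have hc0 : gridPoint t j c < θ k.castSucc.succ := by
    rcases Nat.eq_zero_or_pos c with h0 | h0
    · obtain ⟨i, hi, -, h1⟩ := hA 0 (by norm_num)
      rw [h0]
      exact (hmono.monotone (Nat.zero_le _)).trans_lt h1.1
    · have := Nat.find_min hex (m := c - 1) (by omega)
      rwa [not_le, Nat.sub_add_cancel h0] at this
  -- A grid point of index `i` is an end point of segments with offset `i mod 3`; the offsets `2`,
  -- `N + 1` and `c + 1` are those that bound `c` from below, from above, and exclude `b_{c+1}`.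
  refine ⟨c, ?_, ?_, hc0, lt_of_le_of_ne hc1 fun heq => ?_⟩
  · obtain ⟨i, hi, -, h1⟩ := hA 2 (by norm_num)
    have := hmono.lt_iff_lt.1 (h1.1.trans_le hc1)
    omega
  · obtain ⟨i, hi, hi', h1⟩ := hA ((gridSize t j + 1) % 3) (by omega)
    have := hmono.lt_iff_lt.1 (hc0.trans h1.2)
    omega
  · obtain ⟨i, hi, -, h1⟩ := hA ((c + 1) % 3) (by omega)
    rw [heq] at h1
    have h2 := hmono.lt_iff_lt.1 h1.1
    have h3 := hmono.lt_iff_lt.1 h1.2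
    omega

/-- In a separating grid the selected cells are eventually those that contain the change points. -/
theorem IsTypical.exists_cells (H : IsTypical θ Y ρ) (hM : Tendsto M atTop atTop)
    (hL : Tendsto L atTop atTop) {t j : ℕ} (h : IsSeparating θ ρ t j) :
    ∃ σ : Fin κ → ℕ, StrictMono σ ∧ (∀ k, 2 ≤ σ k ∧ σ k + 3 ≤ gridSize t j ∧
      θ k.castSucc.succ ∈ Set.Ioo (gridPoint t j (σ k)) (gridPoint t j (σ k + 1))) ∧
    ∀ᶠ n in atTop, ∀ s : Fin κ → ℕ, StrictMono s → (∀ k, s k < gridSize t j) →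
      (∀ i < gridSize t j, i ∉ Set.range s → ∀ k,
        cellScore M L n (sample θ n Y) t j i ≤ cellScore M L n (sample θ n Y) t j (s k)) →
      s = σ := by
  have hmono := gridPoint_strictMono t j
  choose σ hσ2 hσN hσ using fun k => H.exists_cell h k
  have hσm : StrictMono σ := by
    intro k k' hkk
    have h1 : θ k.castSucc.succ < θ k'.castSucc.succ :=
      H.strictMono (Fin.succ_lt_succ_iff.2 (Fin.castSucc_lt_castSucc_iff.2 hkk))
    have h2 := hmono.lt_iff_lt.1 (((hσ k).1.trans h1).trans (hσ k').2)
    refine lt_of_le_of_ne (by omega) fun heq => hkk.ne (H.eq_of_mem_triple h (e := σ k) ?_ ?_)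
    · exact ⟨(hσ k).1, (hσ k).2.trans (hmono (by omega))⟩
    · rw [heq]
      exact ⟨(hσ k').1, (hσ k').2.trans (hmono (by omega))⟩
  refine ⟨σ, hσm, fun k => ⟨hσ2 k, hσN k, hσ k⟩, ?_⟩
  have hev : ∀ᶠ n in atTop, ∀ i ∈ (Finset.range (gridSize t j)).filter (· ∉ Set.range σ), ∀ k,
      cellScore M L n (sample θ n Y) t j i < cellScore M L n (sample θ n Y) t j (σ k) := by
    classical
    rw [eventually_all_finset]
    intro i hi
    obtain ⟨hiN, hi⟩ := Finset.mem_filter.1 hi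
    rw [Finset.mem_range] at hiN
    rw [eventually_all]
    intro k
    refine (H.tendsto_segment_score hM hL (Nat.lt_succ_self i) hiN).eventually_lt
      (H.tendsto_segment_score hM hL (Nat.lt_succ_self (σ k)) (by have := hσN k; omega)) ?_
    rw [H.scoreLimit_eq_zero (gridPoint_pos t j _).le (hmono (Nat.lt_succ_self i))
      (gridPoint_le_one hiN)]
    · refine H.scoreLimit_pos (gridPoint_pos t j _).le
        (gridPoint_le_one (by have := hσN k; omega)) (hσ k) fun k' hk' => ?_
      exact H.eq_of_mem_triple h (e := σ k) ⟨hk'.1, hk'.2.trans (hmono (by omega))⟩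
        ⟨(hσ k).1, (hσ k).2.trans (hmono (by omega))⟩
    · intro k' hk'
      refine hi ⟨k', ?_⟩
      have h1 := hmono.lt_iff_lt.1 (hk'.1.trans (hσ k').2)
      have h2 := hmono.lt_iff_lt.1 ((hσ k').1.trans hk'.2)
      omega
  filter_upwards [hev] with n hn s hs hsN htop
  -- A selected cell without change point would be beaten by any cell of a change point that is
  -- left out, and one of the latter exists by counting.
  have hsub : Set.range σ ⊆ Set.range s := by
    rintro _ ⟨k, rfl⟩
    by_contra hk
    have hall : ∀ k', s k' ∈ Set.range σ := by
      intro k'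
      by_contra hk'
      have h1 := hn (s k') (Finset.mem_filter.2 ⟨Finset.mem_range.2 (hsN k'), hk'⟩) k
      have h2 := htop (σ k) (by have := hσN k; omega) hk k'
      linarith
    have hsubset : Finset.univ.image s ⊆ Finset.univ.image σ := by
      intro i hi
      obtain ⟨k', -, rfl⟩ := Finset.mem_image.1 hi
      obtain ⟨k'', hk''⟩ := hall k'
      exact Finset.mem_image.2 ⟨k'', Finset.mem_univ _, hk''⟩
    have heq := Finset.eq_of_subset_of_card_le hsubset (by
      rw [Finset.card_image_of_injective _ hs.injective,
        Finset.card_image_of_injective _ hσm.injective])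
    have hmem : σ k ∈ Finset.univ.image s := heq ▸ Finset.mem_image_of_mem σ (Finset.mem_univ k)
    obtain ⟨k', -, hk'⟩ := Finset.mem_image.1 hmem
    exact hk ⟨k', hk'⟩
  have hsubset : Finset.univ.image σ ⊆ Finset.univ.image s := by
    intro i hi
    obtain ⟨k', -, rfl⟩ := Finset.mem_image.1 hi
    obtain ⟨k'', hk''⟩ := hsub ⟨k', rfl⟩
    exact Finset.mem_image.2 ⟨k'', Finset.mem_univ _, hk''⟩
  have heq := Finset.eq_of_subset_of_card_le hsubset (by
    rw [Finset.card_image_of_injective _ hs.injective,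
      Finset.card_image_of_injective _ hσm.injective])
  refine (hs.range_inj hσm).1 ?_
  have := congrArg (fun S : Finset ℕ => (S : Set ℕ)) heq
  simpa using this.symm

theorem IsTypical.tendsto_candidate (H : IsTypical θ Y ρ) (hM : Tendsto M atTop atTop)
    (hL : Tendsto L atTop atTop) {t j : ℕ} (h : IsSeparating θ ρ t j) {p : ℕ → Fin κ → ℕ}
    (hp : ∀ᶠ n in atTop, IsCandidate M L κ n (sample θ n Y) t j (p n)) (k : Fin κ) :
    Tendsto (fun n => (p n k : ℝ) / n) atTop (𝓝 (θ k.castSucc.succ)) := by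
  have hmono := gridPoint_strictMono t j
  obtain ⟨σ, hσm, hσ, hev⟩ := H.exists_cells hM hL h
  obtain ⟨h2, hN, hk⟩ := hσ k
  have hκN : κ ≤ gridSize t j := by
    have := Finset.card_le_card_of_injOn (s := Finset.univ) (t := Finset.range (gridSize t j)) σ
      (fun k _ => by
        have := (hσ k).2.1
        simp only [Finset.coe_range, Set.mem_Iio]
        omega) hσm.injective.injOn
    simpa using this
  obtain ⟨c, hc⟩ : ∃ c, σ k = c + 1 := ⟨σ k - 1, by omega⟩
  have e1 : gridPoint t j (σ k) - step j = gridPoint t j c := by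
    rw [hc, gridPoint_add]; push_cast; ring
  have e2 : gridPoint t j (σ k + 1) + step j = gridPoint t j (c + 3) := by
    rw [hc, gridPoint_add t j c 3, gridPoint_add, gridPoint_add]; push_cast; ring
  have hk' : θ k.castSucc.succ ∈ Set.Ioo (gridPoint t j c) (gridPoint t j (c + 3)) :=
    ⟨(hmono (by omega)).trans hk.1, hk.2.trans (hmono (by omega))⟩
  refine H.tendsto_of_isPhi hM hL (step_pos j) (by rw [e1]; exact (gridPoint_pos t j c).le)
    (by rw [e2]; exact gridPoint_le_one (by omega)) (tendsto_boundary_div t j (σ k))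
    (tendsto_boundary_div t j (σ k + 1)) hk (fun k' h' => ?_) ?_
  · rw [e1, e2] at h'
    exact H.eq_of_mem_triple h h' hk'
  · filter_upwards [hev, hp] with n hn hpn
    obtain ⟨s, hs, hsN, htop, hphi⟩ := hpn hκN
    rw [← hn s hs hsN htop]
    exact hphi k

theorem IsCandidate.le {n : ℕ} {x : ℕ → ℝ} {t j : ℕ} {p : Fin κ → ℕ}
    (h : IsCandidate M L κ n x t j p) (hn : 1 ≤ n) (hN : κ ≤ gridSize t j) (k : Fin κ) :
    p k ≤ n := by
  obtain ⟨s, -, hsN, -, hphi⟩ := h hN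
  exact (Finset.mem_Icc.1 (hphi k).1).2.trans (boundary_le hn (hsN k))

/-- The error of a candidate matters only if it is a position of the sample: on grids with fewer
than `κ` cells, where candidates are arbitrary, the score is zero. -/
theorem IsTypical.gamma_mul_abs_le (H : IsTypical θ Y ρ) {n t j : ℕ} {x : ℕ → ℝ} {p : Fin κ → ℕ}
    (h : IsCandidate M L κ n x t j p) (hn : 1 ≤ n) (k : Fin κ) :
    gamma M L κ n x t j * |(p k : ℝ) / n - θ k.castSucc.succ| ≤ gamma M L κ n x t j := by
  rcases lt_or_ge (gridSize t j) κ with hN | hN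
  · rw [gamma_eq_zero hN, zero_mul]
  · refine mul_le_of_le_one_right (gamma_mem_Icc M L k.pos n x t j).1 ?_
    have h1 : (p k : ℝ) / n ≤ 1 := by
      rw [div_le_one (by exact_mod_cast hn)]
      exact_mod_cast h.le hn hN k
    have h2 : (0 : ℝ) ≤ (p k : ℝ) / n := by positivity
    have h3 := H.mem_Icc k.castSucc.succ
    rw [abs_le]
    constructor <;> linarith [h3.1, h3.2]

/-- The contribution of a single grid to the error vanishes: either its score does, or its
candidates converge to the change points. -/
theorem IsTypical.tendsto_gamma_mul_abs (H : IsTypical θ Y ρ) (hM : Tendsto M atTop atTop)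
    (hL : Tendsto L atTop atTop) {t j : ℕ} {p : ℕ → Fin κ → ℕ}
    (hp : ∀ᶠ n in atTop, IsCandidate M L κ n (sample θ n Y) t j (p n)) (k : Fin κ) :
    Tendsto (fun n => gamma M L κ n (sample θ n Y) t j *
      |(p n k : ℝ) / n - θ k.castSucc.succ|) atTop (𝓝 0) := by
  by_cases h : IsSeparating θ ρ t j
  · have h1 := ((H.tendsto_candidate hM hL h hp k).sub_const (θ k.castSucc.succ)).abs.const_mul 2
    rw [sub_self, abs_zero, mul_zero] at h1
    refine squeeze_zero (fun n => mul_nonneg (gamma_mem_Icc M L k.pos n _ t j).1 (abs_nonneg _))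
      (fun n => ?_) h1
    exact mul_le_mul_of_nonneg_right (gamma_mem_Icc M L k.pos n _ t j).2 (abs_nonneg _)
  · refine squeeze_zero' (Eventually.of_forall fun n =>
      mul_nonneg (gamma_mem_Icc M L k.pos n _ t j).1 (abs_nonneg _)) ?_
      (H.tendsto_gamma_of_not_isSeparating hM hL k.pos h)
    filter_upwards [hp, eventually_ge_atTop 1] with n hn h1
    exact H.gamma_mul_abs_le hn h1 k

end Typical

section Typical

variable {κ : ℕ} {θ : Fin (κ + 2) → ℝ} {Y : Fin (κ + 1) → ℕ → ℝ} {ρ : Fin (κ + 1) → Masses}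
  {M L : ℕ → ℕ}

/-! ### Existence of a separating grid -/

theorem tendsto_step : Tendsto step atTop (𝓝 0) := by
  have := (tendsto_pow_atTop_nhds_zero_of_lt_one (r := (1 / 2 : ℝ)) (by norm_num)
    (by norm_num)).div_const 3
  rwa [zero_div] at this

/-- The fractional parts of the positions of different grids of the same step differ. -/
theorem eq_of_gridPoint_eq {t t' j i i' : ℕ} (ht : 1 ≤ t) (ht' : 1 ≤ t')
    (h : gridPoint t j i = gridPoint t' j i') : t = t' := by
  have h1 := mul_left_cancel₀ (step_pos j).ne' h
  have hb : ∀ {s : ℕ}, 1 ≤ s → 0 < 1 / ((s : ℝ) + 1) ∧ 1 / ((s : ℝ) + 1) < 1 := fun {s} hs => by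
    have : (1 : ℝ) ≤ s := by exact_mod_cast hs
    exact ⟨by positivity, by rw [div_lt_one] <;> linarith⟩
  have h2 := hb ht
  have h3 := hb ht'
  have h4 : (i : ℝ) < i' + 1 := by linarith
  have h5 : (i' : ℝ) < i + 1 := by linarith
  have h4 : i < i' + 1 := by exact_mod_cast h4
  have h5 : i' < i + 1 := by exact_mod_cast h5
  obtain rfl : i = i' := by omega
  have h6 := add_left_cancel h1
  rw [one_div, one_div, inv_inj] at h6
  exact_mod_cast add_right_cancel h6

/-- The `κ` change points lie on at most `κ` of the `κ + 1` grids of a given step. -/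
theorem exists_grid_avoiding (κ : ℕ) (τ : Fin κ → ℝ) (j : ℕ) :
    ∃ t ∈ Finset.Icc 1 (κ + 1), ∀ k i, τ k ≠ gridPoint t j i := by
  rcases κ.eq_zero_or_pos with rfl | hκ
  · exact ⟨1, by simp, fun k => k.elim0⟩
  have : Nonempty (Fin κ) := ⟨⟨0, hκ⟩⟩
  by_contra! h
  choose! f g hfg using h
  obtain ⟨t, ht, t', ht', hne, heq⟩ := Finset.exists_ne_map_eq_of_card_lt_of_maps_to
    (s := Finset.Icc 1 (κ + 1)) (t := Finset.univ) (f := f) (by simp)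
    (fun _ _ => Finset.mem_coe.2 (Finset.mem_univ _))
  have h1 := hfg t ht
  rw [heq, hfg t' ht'] at h1
  exact hne (eq_of_gridPoint_eq (Finset.mem_Icc.1 ht').1 (Finset.mem_Icc.1 ht).1 h1).symm

/-- A grid which is fine compared with the distances of the change points, and on which no change
point lies, is separating. -/
theorem IsTypical.isSeparating (H : IsTypical θ Y ρ) {t j : ℕ}
    (hgap : ∀ r : Fin (κ + 1), 9 * step j < θ r.succ - θ r.castSucc)
    (hgrid : ∀ (k : Fin κ) i, θ k.castSucc.succ ≠ gridPoint t j i) : IsSeparating θ ρ t j := by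
  intro l hl
  have hmono := gridPoint_strictMono t j
  have hs := step_pos j
  have ht : 1 / ((t : ℝ) + 1) ≤ 1 := by
    rw [div_le_one (by positivity)]
    linarith [Nat.cast_nonneg (α := ℝ) t]
  have ht0 : 0 < 1 / ((t : ℝ) + 1) := by positivity
  have h0 : ∀ k : Fin κ, 9 * step j < θ k.castSucc.succ := fun k => by
    linarith [hgap k.castSucc, (H.mem_Icc k.castSucc.castSucc).1]
  have h1 : ∀ k : Fin κ, θ k.castSucc.succ + 9 * step j < 1 := fun k => by
    have := hgap k.succ
    rw [← Fin.succ_castSucc] at this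
    linarith [(H.mem_Icc k.succ.succ).2]
  have hlt : ∀ {k k' : Fin κ}, k < k' → θ k.castSucc.succ + 9 * step j < θ k'.castSucc.succ := by
    intro k k' hkk
    have h2 : θ k.succ.succ ≤ θ k'.castSucc.succ :=
      H.strictMono.monotone (Fin.succ_le_succ_iff.2 (Fin.succ_le_castSucc_iff.2 hkk))
    have := hgap k.succ
    rw [← Fin.succ_castSucc] at this
    linarith
  have hex : ∀ k : Fin κ, ∃ i, 1 ≤ i ∧ i ≤ (gridSize t j - l) / 3 ∧ θ k.castSucc.succ ∈
      Set.Ioo (gridPoint t j (l + 3 * (i - 1))) (gridPoint t j (l + 3 * i)) := by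
    intro k
    have hex : ∃ i, θ k.castSucc.succ < gridPoint t j (l + 3 * i) := by
      obtain ⟨i, hi⟩ := exists_nat_gt (θ k.castSucc.succ / step j)
      refine ⟨i, ?_⟩
      rw [div_lt_iff₀' hs] at hi
      refine hi.trans_le (mul_le_mul_of_nonneg_left ?_ hs.le)
      push_cast
      linarith [Nat.cast_nonneg (α := ℝ) l, Nat.cast_nonneg (α := ℝ) i]
    classical
    set i := Nat.find hex with hi
    have hi1 : θ k.castSucc.succ < gridPoint t j (l + 3 * i) := Nat.find_spec hex
    have hpos : 1 ≤ i := by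
      by_contra! h
      have : gridPoint t j (l + 3 * i) ≤ gridPoint t j (0 + 3) := hmono.monotone (by omega)
      have h2 := mul_le_mul_of_nonneg_left ht hs.le
      have h3 : gridPoint t j (0 + 3) = step j * (1 / ((t : ℝ) + 1)) + 3 * step j := by
        rw [gridPoint_add, gridPoint, Nat.cast_zero, zero_add, Nat.cast_ofNat]
      linarith [h0 k]
    have hi0 : gridPoint t j (l + 3 * (i - 1)) < θ k.castSucc.succ :=
      lt_of_le_of_ne (not_lt.1 (Nat.find_min hex (m := i - 1) (by omega))) (hgrid k _).symm
    refine ⟨i, hpos, ?_, hi0, hi1⟩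
    have : l + 3 * i ≤ gridSize t j := by
      rw [le_gridSize_iff (by omega), show l + 3 * i = l + 3 * (i - 1) + 3 by omega, gridPoint_add]
      push_cast
      linarith [h1 k]
    omega
  choose g hg1 hgN hg using hex
  have huniq : ∀ (i : ℕ) {k k' : Fin κ}, 1 ≤ i → θ k.castSucc.succ ∈
        Set.Ioo (gridPoint t j (l + 3 * (i - 1))) (gridPoint t j (l + 3 * i)) →
      θ k'.castSucc.succ ∈
        Set.Ioo (gridPoint t j (l + 3 * (i - 1))) (gridPoint t j (l + 3 * i)) → k' = k := by
    intro i k k' hi hk hk'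
    rw [show l + 3 * i = l + 3 * (i - 1) + 3 by omega,
      gridPoint_add t j (l + 3 * (i - 1)) 3, Nat.cast_ofNat] at hk hk'
    rcases lt_trichotomy k' k with h | h | h
    · linarith [hlt h, hk.2, hk'.1]
    · exact h
    · linarith [hlt h, hk'.2, hk.1]
  have hinj : Function.Injective g := fun k k' heq =>
    (huniq (g k) (hg1 k) (hg k) (heq ▸ hg k')).symm
  have hle := Finset.card_le_card_of_injOn (s := Finset.univ) (t := activeTriples θ ρ t j l) g
    (fun k _ => by
      refine Finset.mem_coe.2 (mem_activeTriples.2 ⟨hg1 k, hgN k, ne_of_gt ?_⟩)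
      exact H.scoreLimit_pos (gridPoint_pos t j _).le
        (gridPoint_le_one (by have := hg1 k; have := hgN k; omega)) (hg k)
        fun k' hk' => huniq (g k) (hg1 k) (hg k) hk')
    hinj.injOn
  simpa using hle

theorem IsTypical.exists_isSeparating (H : IsTypical θ Y ρ) :
    ∃ j, 1 ≤ j ∧ ∃ t ∈ Finset.Icc 1 (κ + 1), IsSeparating θ ρ t j := by
  have hev : ∀ᶠ j in atTop, ∀ r : Fin (κ + 1), 9 * step j < θ r.succ - θ r.castSucc := by
    rw [eventually_all]
    intro r
    have h := tendsto_step.const_mul 9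
    rw [mul_zero] at h
    exact h.eventually_lt_const (sub_pos.2 (H.strictMono Fin.castSucc_lt_succ))
  obtain ⟨j, hj, hj1⟩ := (hev.and (eventually_ge_atTop 1)).exists
  obtain ⟨t, ht, hgrid⟩ := exists_grid_avoiding κ (fun k => θ k.castSucc.succ) j
  exact ⟨j, hj1, t, ht, H.isSeparating hj hgrid⟩

/-! ### Convergence of the output -/

/-- The weights `2^{-j} γ(t, j)` have a sum that stays away from zero. -/
theorem IsTypical.eventually_le_eta (H : IsTypical θ Y ρ) (hM : Tendsto M atTop atTop)
    (hL : Tendsto L atTop atTop) (hκ : 0 < κ) :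
    ∃ c > 0, ∀ᶠ n in atTop, c ≤ eta M L κ n (sample θ n Y) := by
  obtain ⟨j, hj, t, ht, h⟩ := H.exists_isSeparating
  obtain ⟨c, hc, hev⟩ := H.eventually_le_gamma hM hL hκ h
  refine ⟨(1 / 2) ^ j * c, by positivity, ?_⟩
  filter_upwards [hev, eventually_ge_atTop (2 ^ j)] with n hn hnj
  have hpos : ∀ j t, 0 ≤ (1 / 2 : ℝ) ^ j * gamma M L κ n (sample θ n Y) t j := fun j t =>
    mul_nonneg (by positivity) (gamma_mem_Icc M L hκ n _ t j).1
  have hjm : j ∈ Finset.Icc 1 (Nat.log 2 n) :=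
    Finset.mem_Icc.2 ⟨hj, Nat.le_log_of_pow_le one_lt_two hnj⟩
  calc (1 / 2) ^ j * c ≤ (1 / 2) ^ j * gamma M L κ n (sample θ n Y) t j := by gcongr
    _ ≤ ∑ t ∈ Finset.Icc 1 (κ + 1), (1 / 2 : ℝ) ^ j * gamma M L κ n (sample θ n Y) t j :=
        Finset.single_le_sum (f := fun t => (1 / 2 : ℝ) ^ j * gamma M L κ n (sample θ n Y) t j)
          (fun t _ => hpos j t) ht
    _ ≤ _ := Finset.single_le_sum (f := fun j => ∑ t ∈ Finset.Icc 1 (κ + 1),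
          (1 / 2 : ℝ) ^ j * gamma M L κ n (sample θ n Y) t j)
          (fun j _ => Finset.sum_nonneg fun t _ => hpos j t) hjm

theorem IsTypical.tendsto_weighted_error (H : IsTypical θ Y ρ) (hM : Tendsto M atTop atTop)
    (hL : Tendsto L atTop atTop) {p : ℕ → ℕ → ℕ → Fin κ → ℕ}
    (hp : ∀ n, ∀ j ∈ Finset.Icc 1 (Nat.log 2 n), ∀ t ∈ Finset.Icc 1 (κ + 1),
      IsCandidate M L κ n (sample θ n Y) t j (p n t j)) (k : Fin κ) :
    Tendsto (fun n => ∑ j ∈ Finset.Icc 1 (Nat.log 2 n), ∑ t ∈ Finset.Icc 1 (κ + 1),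
      (1 / 2 : ℝ) ^ j * (gamma M L κ n (sample θ n Y) t j *
        |(p n t j k : ℝ) / n - θ k.castSucc.succ|)) atTop (𝓝 0) := by
  have hlog : Tendsto (Nat.log 2) atTop atTop := tendsto_atTop.2 fun b => by
    filter_upwards [eventually_ge_atTop (2 ^ b)] with n hn
    exact Nat.le_log_of_pow_le one_lt_two hn
  have key := tendsto_tsum_of_dominated_convergence (𝓕 := atTop)
    (f := fun n j => if j ∈ Finset.Icc 1 (Nat.log 2 n) then ∑ t ∈ Finset.Icc 1 (κ + 1),
      (1 / 2 : ℝ) ^ j * (gamma M L κ n (sample θ n Y) t j *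
        |(p n t j k : ℝ) / n - θ k.castSucc.succ|) else 0)
    (g := fun _ => 0) (bound := fun j => (1 / 2 : ℝ) ^ j * ((κ + 1) * 2))
    (summable_geometric_two.mul_right _) ?_ ?_
  · rw [tsum_zero] at key
    refine key.congr fun n => ?_
    rw [tsum_eq_sum (fun j hj => if_neg hj)]
    exact Finset.sum_congr rfl fun j hj => if_pos hj
  · intro j
    rcases j.eq_zero_or_pos with rfl | hj
    · simp
    have h : Tendsto (fun n => ∑ t ∈ Finset.Icc 1 (κ + 1), (1 / 2 : ℝ) ^ j *
        (gamma M L κ n (sample θ n Y) t j * |(p n t j k : ℝ) / n - θ k.castSucc.succ|)) atTop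
        (𝓝 (∑ t ∈ Finset.Icc 1 (κ + 1), (1 / 2 : ℝ) ^ j * 0)) := by
      refine tendsto_finsetSum _ fun t ht => Tendsto.const_mul _ ?_
      refine H.tendsto_gamma_mul_abs hM hL (p := fun n => p n t j) ?_ k
      filter_upwards [hlog.eventually_ge_atTop j] with n hn
      exact hp n j (Finset.mem_Icc.2 ⟨hj, hn⟩) t ht
    simp only [mul_zero, Finset.sum_const_zero] at h
    refine h.congr' ?_
    filter_upwards [hlog.eventually_ge_atTop j] with n hn
    rw [if_pos (Finset.mem_Icc.2 ⟨hj, hn⟩)]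
  · filter_upwards [eventually_ge_atTop 1] with n hn j
    split_ifs with hj
    · rw [Real.norm_of_nonneg (Finset.sum_nonneg fun t _ => mul_nonneg (by positivity)
        (mul_nonneg (gamma_mem_Icc M L k.pos n _ t j).1 (abs_nonneg _))), ← Finset.mul_sum]
      gcongr
      calc _ ≤ ∑ t ∈ Finset.Icc 1 (κ + 1), (2 : ℝ) := Finset.sum_le_sum fun t ht =>
            (H.gamma_mul_abs_le (hp n j hj t ht) hn k).trans (gamma_mem_Icc M L k.pos n _ t j).2
        _ = (κ + 1) * 2 := by simp
    · rw [norm_zero]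
      positivity

theorem IsTypical.tendsto_output (H : IsTypical θ Y ρ) (hM : Tendsto M atTop atTop)
    (hL : Tendsto L atTop atTop) {est : ℕ → Fin κ → ℝ}
    (hest : ∀ n, IsOutput M L κ n (sample θ n Y) (est n)) (k : Fin κ) :
    Tendsto (fun n => |est n k - θ k.castSucc.succ|) atTop (𝓝 0) := by
  choose p hp hest using hest
  obtain ⟨c, hc, hev⟩ := H.eventually_le_eta hM hL k.pos
  have h0 := (H.tendsto_weighted_error hM hL hp k).const_mul (1 / c)
  rw [mul_zero] at h0
  refine squeeze_zero' (Eventually.of_forall fun n => abs_nonneg _) ?_ h0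
  filter_upwards [hev, eventually_gt_atTop 0] with n hn hn0
  have hη : 0 < eta M L κ n (sample θ n Y) := hc.trans_le hn
  have hn0 : (n : ℝ) ≠ 0 := by exact_mod_cast hn0.ne'
  have heq : est n k - θ k.castSucc.succ = 1 / eta M L κ n (sample θ n Y) *
      ∑ j ∈ Finset.Icc 1 (Nat.log 2 n), ∑ t ∈ Finset.Icc 1 (κ + 1),
        (1 / 2 : ℝ) ^ j * (gamma M L κ n (sample θ n Y) t j *
          ((p n t j k : ℝ) / n - θ k.castSucc.succ)) := by
    have h1 : ∀ j t, (1 / 2 : ℝ) ^ j * (gamma M L κ n (sample θ n Y) t j *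
          ((p n t j k : ℝ) / n - θ k.castSucc.succ)) =
        1 / (n : ℝ) * ((1 / 2 : ℝ) ^ j * gamma M L κ n (sample θ n Y) t j * (p n t j k : ℝ)) -
          (1 / 2 : ℝ) ^ j * gamma M L κ n (sample θ n Y) t j * θ k.castSucc.succ := by
      intro j t
      ring
    simp_rw [h1, Finset.sum_sub_distrib, ← Finset.mul_sum, ← Finset.sum_mul]
    change _ = 1 / eta M L κ n (sample θ n Y) * (_ - eta M L κ n (sample θ n Y) * _)
    rw [hest n k]
    field_simp
  rw [heq, abs_mul, abs_of_pos (one_div_pos.2 hη)]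
  refine mul_le_mul (one_div_le_one_div_of_le hc hn) ?_ (abs_nonneg _) (by positivity)
  refine (Finset.abs_sum_le_sum_abs _ _).trans (Finset.sum_le_sum fun j _ => ?_)
  refine (Finset.abs_sum_le_sum_abs _ _).trans (Finset.sum_le_sum fun t _ => ?_)
  rw [abs_mul, abs_mul, abs_of_nonneg (gamma_mem_Icc M L k.pos n _ t j).1,
    abs_of_pos (by positivity)]

end Typical

/-! ### Cubes determine the law of a process -/

theorem measurable_block (m i : ℕ) : Measurable fun y : ℕ → ℝ => block y m i :=
  measurable_pi_lambda _ fun _ => measurable_pi_apply _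

theorem measurable_cubeIndex (m l : ℕ) : Measurable (cubeIndex (m := m) l) :=
  measurable_pi_lambda _ fun r =>
    Int.measurable_floor.comp ((measurable_pi_apply r).mul_const _)

theorem setOf_block_mem_cube (m l : ℕ) (c : Fin m → ℤ) :
    {y : ℕ → ℝ | block y m 0 ∈ cube l c} = (fun y => cubeIndex l (block y m 0)) ⁻¹' {c} := by
  ext y
  simp only [Set.mem_ofPred_eq, mem_cube_iff, Set.mem_preimage, Set.mem_singleton_iff]
  exact eq_comm

theorem hasSum_real_cube (μ : Measure (ℕ → ℝ)) [IsProbabilityMeasure μ] (m l : ℕ) :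
    HasSum (fun c : Fin m → ℤ => μ.real {y | block y m 0 ∈ cube l c}) 1 := by
  have hmeas : Measurable fun y : ℕ → ℝ => cubeIndex l (block y m 0) :=
    (measurable_cubeIndex m l).comp (measurable_block m 0)
  have h := measure_iUnion (μ := μ) (f := fun c : Fin m → ℤ => {y | block y m 0 ∈ cube l c})
    (fun c c' hcc => by
      rw [Function.onFun, setOf_block_mem_cube, setOf_block_mem_cube]
      exact Disjoint.preimage _ (Set.disjoint_singleton.2 hcc))
    (fun c => by
      rw [setOf_block_mem_cube]
      exact hmeas (measurableSet_singleton c))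
  have huniv : ⋃ c : Fin m → ℤ, {y : ℕ → ℝ | block y m 0 ∈ cube l c} = Set.univ :=
    Set.eq_univ_of_forall fun y => Set.mem_iUnion.2 ⟨cubeIndex l (block y m 0), mem_cube_iff.2 rfl⟩
  rw [huniv, measure_univ] at h
  have h2 := ENNReal.hasSum_toReal (f := fun c : Fin m → ℤ => μ {y | block y m 0 ∈ cube l c})
    (by rw [← h]; exact ENNReal.one_ne_top)
  rwa [← ENNReal.tsum_toReal_eq fun c => measure_ne_top μ _, ← h, ENNReal.toReal_one] at h2

/-- The lower corner of the cube of side `2 ^ (-l)` with index `c`, continued by zeros: if `c` is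
the index of the first `l` entries of a sequence, these entries rounded down to multiples of
`2 ^ (-l)`. -/
noncomputable def roundDown (l : ℕ) (c : Fin l → ℤ) : ℕ → ℝ :=
  fun i => if h : i < l then (c ⟨i, h⟩ : ℝ) / 2 ^ l else 0

theorem tendsto_roundDown (y : ℕ → ℝ) :
    Tendsto (fun l => roundDown l (cubeIndex l (block y l 0))) atTop (𝓝 y) := by
  rw [tendsto_pi_nhds]
  intro i
  have h0 : Tendsto (fun l : ℕ => (1 / 2 : ℝ) ^ l) atTop (𝓝 0) :=
    tendsto_pow_atTop_nhds_zero_of_lt_one (by norm_num) (by norm_num)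
  have h1 := h0.const_sub (y i)
  rw [sub_zero] at h1
  refine tendsto_of_tendsto_of_tendsto_of_le_of_le' h1 tendsto_const_nhds ?_ ?_
  · filter_upwards [eventually_gt_atTop i] with l hl
    rw [roundDown, dif_pos hl, le_div_iff₀ (by positivity)]
    have := Int.sub_one_lt_floor (block y l 0 ⟨i, hl⟩ * 2 ^ l)
    simp only [cubeIndex]
    simp only [block, zero_add] at this ⊢
    rw [sub_mul, ← mul_pow]
    norm_num
    linarith
  · filter_upwards [eventually_gt_atTop i] with l hl
    rw [roundDown, dif_pos hl, div_le_iff₀ (by positivity)]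
    have := Int.floor_le (block y l 0 ⟨i, hl⟩ * 2 ^ l)
    simp only [cubeIndex]
    simp only [block, zero_add] at this ⊢
    exact this

/-- Two process laws that agree on all cubes are equal: a bounded continuous function of the
sequence is the limit of the same function of the discretized initial segments. -/
theorem ext_of_real_cube {μ ν : Measure (ℕ → ℝ)} [IsProbabilityMeasure μ] [IsProbabilityMeasure ν]
    (h : ∀ m l, 1 ≤ m → 1 ≤ l → ∀ c : Fin m → ℤ,
      μ.real {y | block y m 0 ∈ cube l c} = ν.real {y | block y m 0 ∈ cube l c}) : μ = ν := by
  have hmeas : ∀ l : ℕ, Measurable fun y : ℕ → ℝ => cubeIndex l (block y l 0) := fun l =>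
    (measurable_cubeIndex l l).comp (measurable_block l 0)
  have hmap : ∀ l : ℕ, 1 ≤ l → μ.map (fun y => cubeIndex l (block y l 0)) =
      ν.map (fun y => cubeIndex l (block y l 0)) := by
    intro l hl
    refine Measure.ext_of_singleton fun c => ?_
    rw [Measure.map_apply (hmeas l) (measurableSet_singleton c),
      Measure.map_apply (hmeas l) (measurableSet_singleton c), ← setOf_block_mem_cube]
    exact (measureReal_eq_measureReal_iff).1 (h l l hl hl c)
  refine ext_of_forall_integral_eq_of_IsFiniteMeasure fun f => ?_
  have hlim : ∀ (η : Measure (ℕ → ℝ)) [IsProbabilityMeasure η], Tendsto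
      (fun l => ∫ c, f (roundDown l c) ∂(η.map fun y => cubeIndex l (block y l 0))) atTop
      (𝓝 (∫ y, f y ∂η)) := by
    intro η _
    have h1 : Tendsto (fun l => ∫ y, f (roundDown l (cubeIndex l (block y l 0))) ∂η) atTop
        (𝓝 (∫ y, f y ∂η)) := by
      refine tendsto_integral_of_dominated_convergence (fun _ => ‖f‖) (fun l => ?_)
        (integrable_const _) (fun l => Eventually.of_forall fun y => f.norm_coe_le_norm _)
        (Eventually.of_forall fun y => (f.continuous.tendsto y).comp (tendsto_roundDown y))
      exact ((measurable_of_countable fun c => f (roundDown l c)).comp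
        (hmeas l)).aestronglyMeasurable
    refine h1.congr fun l => ?_
    rw [integral_map (hmeas l).aemeasurable
      (measurable_of_countable fun c => f (roundDown l c)).aestronglyMeasurable]
  refine tendsto_nhds_unique_of_eventuallyEq (hlim μ) (hlim ν) ?_
  filter_upwards [eventually_ge_atTop 1] with l hl
  rw [hmap l hl]

/-- Almost every realization is typical. -/
theorem ae_isTypical {Ω : Type*} [MeasurableSpace Ω] (P : Measure Ω) [IsProbabilityMeasure P]
    {κ : ℕ} (X : Fin (κ + 1) → ℕ → Ω → ℝ) (hX : ∀ k i, Measurable (X k i))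
    (hse : ∀ k, IsStationaryErgodic (P.map fun ω i => X k i ω))
    (hne : ∀ k : Fin κ,
      P.map (fun ω i => X k.castSucc i ω) ≠ P.map (fun ω i => X k.succ i ω))
    (θ : Fin (κ + 2) → ℝ) (hθ0 : θ 0 = 0) (hθ1 : θ (Fin.last (κ + 1)) = 1) (hθ : StrictMono θ) :
    ∀ᵐ ω ∂P, IsTypical θ (fun k i => X k i ω) fun r m l c =>
      (P.map fun ω i => X r i ω).real {y | block y m 0 ∈ cube l c} := by
  have hmeas : ∀ k, Measurable fun ω i => X k i ω := fun k => measurable_pi_lambda _ (hX k)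
  have hprob : ∀ k, IsProbabilityMeasure (P.map fun ω i => X k i ω) := fun k =>
    Measure.isProbabilityMeasure_map (hmeas k).aemeasurable
  have hae : ∀ᵐ ω ∂P, ∀ r m l, ∀ c : Fin m → ℤ,
      Tendsto (fun n : ℕ => freq (fun i => X r i ω) 0 n (cube l c)) atTop
        (𝓝 ((P.map fun ω i => X r i ω).real {y | block y m 0 ∈ cube l c})) := by
    simp only [ae_all_iff]
    exact fun r m l c => ae_of_ae_map (hmeas r).aemeasurable ((hse r).2 m l c)
  filter_upwards [hae] with ω hω
  refine ⟨hθ0, hθ1, hθ, fun _ _ _ _ => measureReal_nonneg, fun r m l => hasSum_real_cube _ m l,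
    hω, fun k => ?_⟩
  by_contra! h
  exact hne k (ext_of_real_cube fun m l hm hl c => congrFun (h m l hm hl) c)

end ChangePoint

theorem theorem1 {Ω : Type*} [MeasurableSpace Ω] (P : Measure Ω) [IsProbabilityMeasure P]
    (κ : ℕ) (X : Fin (κ + 1) → ℕ → Ω → ℝ) (hX : ∀ k i, Measurable (X k i))
    (hse : ∀ k, ChangePoint.IsStationaryErgodic (P.map fun ω i => X k i ω))
    (hne : ∀ k : Fin κ,
      P.map (fun ω i => X k.castSucc i ω) ≠ P.map (fun ω i => X k.succ i ω))
    (θ : Fin (κ + 2) → ℝ) (hθ0 : θ 0 = 0) (hθ1 : θ (Fin.last (κ + 1)) = 1) (hθ : StrictMono θ)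
    (M L : ℕ → ℕ) (hM : Tendsto M atTop atTop) (hL : Tendsto L atTop atTop) :
    ∀ᵐ ω ∂P, ∀ est : ℕ → Fin κ → ℝ,
      (∀ n, ChangePoint.IsOutput M L κ n
        (ChangePoint.sample θ n fun k i => X k i ω) (est n)) →
      Tendsto (fun n => ⨆ k : Fin κ, |est n k - θ k.castSucc.succ|) atTop (𝓝 0) := by
  filter_upwards [ChangePoint.ae_isTypical P X hX hse hne θ hθ0 hθ1 hθ] with ω H est hest
  have h := tendsto_finsetSum Finset.univ fun k (_ : k ∈ Finset.univ) =>
    H.tendsto_output hM hL hest k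
  rw [Finset.sum_const_zero] at h
  refine squeeze_zero (fun n => Real.iSup_nonneg fun k => abs_nonneg _) (fun n => ?_) h
  exact Real.iSup_le (fun k => Finset.single_le_sum
    (f := fun k : Fin κ => |est n k - θ k.castSucc.succ|) (fun _ _ => abs_nonneg _)
    (Finset.mem_univ k)) (Finset.sum_nonneg fun _ _ => abs_nonneg _)
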